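/- Let $\mathcal H$ be a finite-dimensional complex Hilbert space with orthonormal basis $e_1,\dots,e_N$ and dual basis $x_1,\dots,x_N$. Identify symmetric tensors in $S^k(\mathcal H^*)\subseteq(\mathcal H^*)^{\otimes k}$ with homogeneous polynomials of degree $k$ in $x_1,\dots,x_N$ (so $\ell^{\otimes k}$ corresponds to $\ell^k$). Let $I\subseteq\mathbb C[x_1,\dots,x_N]$ be a homogeneous ideal with degree-$k$ component $I_k\subseteq S^k(\mathcal H^*)$, and let $I_k^\perp\subseteq S^k(\mathcal H)$ be the annihilator of $I_k$ under the bilinear pairing of $S^k(\mathcal H^*)$ with $S^k(\mathcal H)$. Let $$X=\{\psi\psi^* : \|\psi\|=1,\ f(\psi)=0\text{ for all }f\in I\},$$ and assume $X\neq\emptyset$. Let $X^k=\operatorname{span}\{\psi^{\otimes k}:\psi\psi^*\in X\}$. Let either $W_k=I_k^\perp$ for all $k$, or $W_k=X^k$ for all $k$, and let $\Pi_{W_k}$ be the orthogonal projection of $\mathcal H^{\otimes k}$ onto $W_k$. (1) Let $H$ be a Hermitian operator on $\mathcal H$. Then the maximum $H_X^{\uparrow}=\max_{\psi\psi^*\in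 X}\langle\psi,H\psi\rangle$ and the minimum $H_X^{\downarrow}=\min_{\psi\psi^*\in X}\langle\psi,H\psi\rangle$ exist. For $k\ge1$ let $H_k=\Pi_{W_k}(H\otimes\mathbb 1^{\otimes k-1})\Pi_{W_k}$, and let $\nu_k$ and $\mu_k$ be the largest and the smallest eigenvalue of $H_k$ as an operator on $W_k$ (these exist). Then $\nu_1\ge\nu_2\ge\cdots$ and $\lim_k\nu_k=H_X^{\uparrow}$, and $\mu_1\le\mu_2\le\cdots$ and $\lim_k\mu_k=H_X^{\downarrow}$. If $H_X^{\uparrow}\ge0$, then each $\nu_k$ is also the largest eigenvalue of $H_k$ on all of $\mathcal H^{\otimes k}$; if $H_X^{\downarrow}\le0$, then each $\mu_k$ is also the smallest eigenvalue of $H_k$ on all of $\mathcal H^{\otimes k}$. (2) Let $U\subseteq\mathcal H$ be a linear subspace with orthogonal projection $\Pi_U$, and let $E_X(U)=1-\max_{\psi\psi^*\in X}\langle\psi,\Pi_U\psi\rangle$ be its geometric measure of $X$-tanglement. For $k\ge1$ let $\nu_k$ be the largest eigenvalue of $\Pi_{W_k}(\Pi_U\otimes\mathbb 1^{\otimes k-1})\Pi_{W_k}$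 on $\mathcal H^{\otimes k}$. Then $\nu_1\ge\nu_2\ge\cdots$ and $E_X(U)=1-\lim_{k\to\infty}\nu_k$. -/

import Mathlib

open scoped InnerProductSpace

namespace XTangle

noncomputable section

/-- The `k`-fold Hilbert space tensor power of a complex Hilbert space with an orthonormal basis
indexed by `ι`, written in the product basis: the coordinate at `i : Fin k → ι` is the coefficient
of `b (i 0) ⊗ ⋯ ⊗ b (i (k-1))`. -/
abbrev Tensors (ι : Type*) (k : ℕ) : Type _ := EuclideanSpace ℂ (Fin k → ι)

variable {E : Type*} [NormedAddCommGroup E] [InnerProductSpace ℂ E]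
variable {ι : Type*} [Fintype ι]

/-- The product tensor `φ 0 ⊗ ⋯ ⊗ φ (k-1)`. -/
def productTensor (b : OrthonormalBasis ι ℂ E) {k : ℕ} (φ : Fin k → E) : Tensors ι k :=
  WithLp.toLp 2 fun i => ∏ j, b.repr (φ j) (i j)

/-- The operator `T 0 ⊗ ⋯ ⊗ T (k-1)` on the `k`-fold tensor power. -/
def tensorOp [DecidableEq ι] (b : OrthonormalBasis ι ℂ E) {k : ℕ} (T : Fin k → E →ₗ[ℂ] E) :
    Tensors ι k →ₗ[ℂ] Tensors ι k :=
  Matrix.toEuclideanLin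
    (Matrix.of fun i i' : Fin k → ι => ∏ j, ⟪b (i j), T j (b (i' j))⟫_ℂ)

/-- The inner product of product tensors is the product of the inner products. -/
theorem inner_productTensor (b : OrthonormalBasis ι ℂ E) {k : ℕ} (φ χ : Fin k → E) :
    ⟪productTensor b φ, productTensor b χ⟫_ℂ = ∏ j, ⟪φ j, χ j⟫_ℂ := by
  have h : ∀ j, ⟪φ j, χ j⟫_ℂ = ∑ a, (b.repr (χ j) a) * star (b.repr (φ j) a) := by
    intro j
    rw [← b.repr.inner_map_map, PiLp.inner_apply]
    simp
  simp only [h, Finset.prod_univ_sum, Fintype.piFinset_univ]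
  rw [PiLp.inner_apply]
  simp [productTensor, Finset.prod_mul_distrib]

/-- `T 0 ⊗ ⋯ ⊗ T (k-1)` acts factor by factor on product tensors. -/
theorem tensorOp_productTensor [DecidableEq ι] (b : OrthonormalBasis ι ℂ E) {k : ℕ} (T : Fin k → E →ₗ[ℂ] E)
    (φ : Fin k → E) :
    tensorOp b T (productTensor b φ) = productTensor b fun j => T j (φ j) := by
  ext i
  have h : ∀ j, b.repr (T j (φ j)) (i j)
      = ∑ a, ⟪b (i j), T j (b a)⟫_ℂ * b.repr (φ j) a := by
    intro j
    conv_lhs => rw [← b.sum_repr (φ j)]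
    simp [b.repr_apply_apply, mul_comm]
  simp only [productTensor, h, Finset.prod_univ_sum, Fintype.piFinset_univ]
  simp [tensorOp, Matrix.toEuclideanLin, Matrix.mulVec, dotProduct, Finset.prod_mul_distrib]

/-- The operator `H ⊗ 1^{⊗(k-1)}` on the `k`-fold tensor power (for `k ≥ 1`). -/
def onFirst [DecidableEq ι] (b : OrthonormalBasis ι ℂ E) (k : ℕ) (H : E →ₗ[ℂ] E) :
    Tensors ι k →ₗ[ℂ] Tensors ι k :=
  tensorOp b fun j => if (j : ℕ) = 0 then H else LinearMap.id

/-- The symmetric subspace `S^k`: the tensors fixed by every permutation of the factors. -/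
def symTensors (ι : Type*) (k : ℕ) : Submodule ℂ (Tensors ι k) where
  carrier := {v | ∀ (σ : Equiv.Perm (Fin k)) (i : Fin k → ι), v (i ∘ σ) = v i}
  zero_mem' := fun _ _ => rfl
  add_mem' := fun {v w} hv hw σ i => by simp [hv σ i, hw σ i]
  smul_mem' := fun c v hv σ i => by simp [hv σ i]

/-- The polynomial attached to the tensor `∑ i, t i • (x (i 0) ⊗ ⋯ ⊗ x (i (k-1)))` over the dual
space (with `x` the dual basis): it sends `ℓ ⊗ ⋯ ⊗ ℓ` to `ℓ ^ k`, and identifies the symmetric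
tensors over the dual space with the homogeneous polynomials of degree `k`. -/
def tensorPoly (k : ℕ) : Tensors ι k →ₗ[ℂ] MvPolynomial ι ℂ :=
  Fintype.linearCombination ℂ (fun i : Fin k → ι => ∏ j, MvPolynomial.X (i j)) ∘ₗ
    (WithLp.linearEquiv 2 ℂ ((Fin k → ι) → ℂ)).toLinearMap

/-- The polynomial of `t` evaluated at `ψ` is the bilinear pairing of `t` with `ψ ⊗ ⋯ ⊗ ψ`. -/
theorem eval_tensorPoly (b : OrthonormalBasis ι ℂ E) {k : ℕ} (t : Tensors ι k) (ψ : E) :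
    MvPolynomial.eval (fun a => b.repr ψ a) (tensorPoly k t)
      = ∑ i, t i * productTensor b (fun _ => ψ) i := by
  simp [tensorPoly, Fintype.linearCombination_apply, productTensor, MvPolynomial.smul_eval]

/-- The degree `k` component `I_k` of an ideal, as a space of symmetric tensors over the dual. -/
def idealComponent (I : Ideal (MvPolynomial ι ℂ)) (k : ℕ) : Submodule ℂ (Tensors ι k) :=
  symTensors ι k ⊓ (I.restrictScalars ℂ).comap (tensorPoly k)

/-- `I_k^⊥`: the symmetric tensors annihilated by `I_k` under the bilinear pairing. -/
def idealPerp (I : Ideal (MvPolynomial ι ℂ)) (k : ℕ) : Submodule ℂ (Tensors ι k) where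
  carrier := {v | v ∈ symTensors ι k ∧ ∀ t ∈ idealComponent I k, ∑ i, t i * v i = 0}
  zero_mem' := ⟨zero_mem _, fun t _ => by simp⟩
  add_mem' := fun {v w} hv hw => ⟨add_mem hv.1 hw.1, fun t ht => by
    simp [mul_add, Finset.sum_add_distrib, hv.2 t ht, hw.2 t ht]⟩
  smul_mem' := fun c v hv => ⟨Submodule.smul_mem _ c hv.1, fun t ht => by
    have h := congrArg (c * ·) (hv.2 t ht)
    simp only [Finset.mul_sum, mul_zero] at h
    rw [← h]
    exact Finset.sum_congr rfl fun i _ => by simp; ring⟩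

/-- The pure state `ψψ*`, as the operator `χ ↦ ⟪ψ, χ⟫ ψ`. -/
def pureState (ψ : E) : E →L[ℂ] E := InnerProductSpace.rankOne ℂ ψ ψ

/-- The variety `V(I)`: the pure states `ψψ*`, `ψ` a unit vector, with `f(ψ) = 0` for all
`f ∈ I`, polynomials being evaluated in the coordinates of the basis `b`. -/
def variety (b : OrthonormalBasis ι ℂ E) (I : Ideal (MvPolynomial ι ℂ)) : Set (E →L[ℂ] E) :=
  {P | ∃ ψ : E, ‖ψ‖ = 1 ∧ (∀ f ∈ I, MvPolynomial.eval (fun a => b.repr ψ a) f = 0) ∧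
    P = pureState ψ}

/-- `X^k`: the span of the tensors `ψ ⊗ ⋯ ⊗ ψ` with `ψψ* ∈ X`. -/
def varietyPower (b : OrthonormalBasis ι ℂ E) (X : Set (E →L[ℂ] E)) (k : ℕ) :
    Submodule ℂ (Tensors ι k) :=
  Submodule.span ℂ {v | ∃ ψ : E, pureState ψ ∈ X ∧ v = productTensor b fun _ => ψ}

/-- The values `⟨ψ, Hψ⟩` (real when `H` is Hermitian) for `ψψ* ∈ X`. -/
def valuesOn (X : Set (E →L[ℂ] E)) (H : E →ₗ[ℂ] E) : Set ℝ :=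
  {r | ∃ ψ : E, pureState ψ ∈ X ∧ r = (⟪ψ, H ψ⟫_ℂ).re}

/-- The maximum of `⟨ψ, Hψ⟩` over `ψψ* ∈ X`. -/
def maxOn (X : Set (E →L[ℂ] E)) (H : E →ₗ[ℂ] E) : ℝ := sSup (valuesOn X H)

/-- The minimum of `⟨ψ, Hψ⟩` over `ψψ* ∈ X`. -/
def minOn (X : Set (E →L[ℂ] E)) (H : E →ₗ[ℂ] E) : ℝ := sInf (valuesOn X H)

/-- The operator `Π_W (H ⊗ 1^{⊗(k-1)}) Π_W` on the `k`-fold tensor power, with `Π_W` the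
orthogonal projection onto `W`. -/
def levelOp [DecidableEq ι] (b : OrthonormalBasis ι ℂ E) {k : ℕ} (W : Submodule ℂ (Tensors ι k))
    (H : E →ₗ[ℂ] E) : Tensors ι k →ₗ[ℂ] Tensors ι k :=
  W.starProjection.toLinearMap ∘ₗ onFirst b k H ∘ₗ W.starProjection.toLinearMap

/-- The real eigenvalues of `T` with an eigenvector in `W`; for `W` invariant under `T` these are
the eigenvalues of `T` as an operator on `W`. -/
def eigenvaluesOn {V : Type*} [AddCommGroup V] [Module ℂ V] (W : Submodule ℂ V)
    (T : V →ₗ[ℂ] V) : Set ℝ :=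
  {μ | ∃ v ∈ W, v ≠ 0 ∧ T v = (μ : ℂ) • v}

/-- The largest eigenvalue of `T` as an operator on `W`. -/
def lambdaMax {V : Type*} [AddCommGroup V] [Module ℂ V] (W : Submodule ℂ V)
    (T : V →ₗ[ℂ] V) : ℝ := sSup (eigenvaluesOn W T)

/-- The smallest eigenvalue of `T` as an operator on `W`. -/
def lambdaMin {V : Type*} [AddCommGroup V] [Module ℂ V] (W : Submodule ℂ V)
    (T : V →ₗ[ℂ] V) : ℝ := sInf (eigenvaluesOn W T)

/-- The geometric measure of `X`-tanglement of a subspace `U`. -/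
def geometricMeasure [FiniteDimensional ℂ E] (X : Set (E →L[ℂ] E)) (U : Submodule ℂ E) : ℝ :=
  1 - maxOn X U.starProjection.toLinearMap

end

end XTangle

attribute [local instance] MvPolynomial.gradedAlgebra

/-! On `W k` the largest eigenvalue $\nu_k$ is the maximum of $\langle v,(H\otimes 1)v\rangle$ over
unit $v\in W_k$. If $\psi\psi^*\in X$, then $\psi^{\otimes k}\in W_k$ has value
$\langle\psi,H\psi\rangle$, so $\nu_k\ge H_X^\uparrow$. Both choices of `W` consist of symmetric
tensors and are closed under contracting a factor (`IsContractive`); slicing a maximizer along its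
last factor therefore gives $\nu_{k+1}\le\nu_k$.

The limit is a quantum de Finetti argument. The partial traces of $v_nv_n^*$, with $v_n$ a maximizer
at level $n+1$, form a compatible family of density operators up to that level. By compactness these
families accumulate at an infinite one whose $k$-th member has range in $W_k$ and whose one-particle
expectation is at least $\inf_k\nu_k$ (`exists_exchangeable_of_forall_level`). A linear functional
on the compact set of such families attains its maximum at an extreme point
(`exists_expectation_le`), and extreme points are powers of one pure state $\psi\psi^*$ with every
$\psi^{\otimes k}\in W_k$ (`exists_eq_prod_of_mem_extremePoints`). For both choices of `W` this
means $\psi\psi^*\in X$ (`pureState_mem_iff`), so $\inf_k\nu_k\le H_X^\uparrow$.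

Minima follow by passing to $-H$; the geometric measure is the case $H=\Pi_U$. -/

namespace XTangle
open Filter Topology

/-! ### Extreme eigenvalues on an invariant subspace. -/

section Spectral

variable {V : Type*} [NormedAddCommGroup V] [InnerProductSpace ℂ V]

theorem eigenvaluesOn_mono {W W' : Submodule ℂ V} (h : W ≤ W') (T : V →ₗ[ℂ] V) :
    eigenvaluesOn W T ⊆ eigenvaluesOn W' T :=
  fun _ ⟨v, hv, hv0, hTv⟩ => ⟨v, h hv, hv0, hTv⟩

theorem re_inner_eigenvector {T : V →ₗ[ℂ] V} {v : V} {μ : ℝ} (h : T v = (μ : ℂ) • v) :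
    (⟪v, T v⟫_ℂ).re = μ * ‖v‖ ^ 2 := by
  rw [h, inner_smul_right, inner_self_eq_norm_sq_to_K, Complex.re_ofReal_mul]
  norm_cast

/-- In finite dimension the supremum of the Rayleigh quotient of the restriction to `W` is an
eigenvalue. It dominates all others because an eigenvector has its eigenvalue as Rayleigh quotient.
-/
theorem isGreatest_eigenvaluesOn [FiniteDimensional ℂ V] {W : Submodule ℂ V} (hW : W ≠ ⊥) {T : V →ₗ[ℂ] V}
    (hT : T.IsSymmetric) (hTW : ∀ v ∈ W, T v ∈ W) :
    IsGreatest (eigenvaluesOn W T) (lambdaMax W T) ∧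
      ∀ v ∈ W, (⟪v, T v⟫_ℂ).re ≤ lambdaMax W T * ‖v‖ ^ 2 := by
  have : Nontrivial W := (Submodule.nontrivial_iff_ne_bot).2 hW
  let S := T.restrict hTW
  have hS : S.IsSymmetric := hT.restrict_invariant hTW
  set r : ℝ := ⨆ x : {x : W // x ≠ 0}, RCLike.re ⟪S x, x⟫_ℂ / ‖(x : W)‖ ^ 2 with hr
  have hbdd : BddAbove (Set.range fun x : {x : W // x ≠ 0} =>
      RCLike.re ⟪S x, x⟫_ℂ / ‖(x : W)‖ ^ 2) := by
    refine ⟨‖S.toContinuousLinearMap‖, ?_⟩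
    rintro _ ⟨x, rfl⟩
    have hx : 0 < ‖(x : W)‖ := norm_pos_iff.2 x.2
    rw [div_le_iff₀ (by positivity)]
    calc RCLike.re ⟪S x, x⟫_ℂ ≤ ‖S x‖ * ‖(x : W)‖ := re_inner_le_norm _ _
      _ ≤ (‖S.toContinuousLinearMap‖ * ‖(x : W)‖) * ‖(x : W)‖ := by
        gcongr
        exact S.toContinuousLinearMap.le_opNorm x
      _ = _ := by ring
  have hle : ∀ v ∈ W, (⟪v, T v⟫_ℂ).re ≤ r * ‖v‖ ^ 2 := by
    intro v hv
    rcases eq_or_ne v 0 with rfl | hv0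
    · simp
    · have h1 := le_ciSup hbdd ⟨⟨v, hv⟩, by simpa using hv0⟩
      have hx : 0 < ‖v‖ := norm_pos_iff.2 hv0
      rw [← hr, div_le_iff₀ (by simpa using by positivity)] at h1
      have h2 : ⟪v, T v⟫_ℂ = ⟪T v, v⟫_ℂ := (hT v v).symm
      rw [h2]
      exact h1
  have hmem : r ∈ eigenvaluesOn W T := by
    obtain ⟨v, hv⟩ := hS.hasEigenvalue_iSup_of_finiteDimensional.exists_hasEigenvector
    refine ⟨v, v.2, by simpa using hv.2, ?_⟩
    exact congrArg Subtype.val hv.apply_eq_smul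
  have hgr : IsGreatest (eigenvaluesOn W T) r := by
    refine ⟨hmem, ?_⟩
    rintro μ ⟨v, hv, hv0, hTv⟩
    have h := hle v hv
    rw [re_inner_eigenvector hTv] at h
    exact le_of_mul_le_mul_right h (by have := norm_pos_iff.2 hv0; positivity)
  have : lambdaMax W T = r := hgr.csSup_eq
  rw [this]
  exact ⟨hgr, hle⟩

/-- An eigenvector with nonzero eigenvalue lies in the range of `T`, hence in `W`. Enlarging `W` to
the whole space can thus only add the eigenvalue 0, which is harmless when `0 ≤ μ`. -/
theorem isGreatest_eigenvaluesOn_top {W : Submodule ℂ V} {T : V →ₗ[ℂ] V}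
    (hTW : ∀ v, T v ∈ W) {μ : ℝ} (hμ : 0 ≤ μ) (h : IsGreatest (eigenvaluesOn W T) μ) :
    IsGreatest (eigenvaluesOn ⊤ T) μ := by
  refine ⟨eigenvaluesOn_mono le_top T h.1, ?_⟩
  rintro x ⟨v, -, hv0, hTv⟩
  rcases eq_or_ne x 0 with rfl | hx
  · exact hμ
  · refine h.2 ⟨v, ?_, hv0, hTv⟩
    have hx' : (x : ℂ) ≠ 0 := by exact_mod_cast hx
    have : v = (x : ℂ)⁻¹ • T v := by rw [hTv, inv_smul_smul₀ hx']
    rw [this]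
    exact W.smul_mem _ (hTW v)

theorem eigenvaluesOn_neg (W : Submodule ℂ V) (T : V →ₗ[ℂ] V) :
    eigenvaluesOn W (-T) = -eigenvaluesOn W T := by
  ext μ
  simp only [eigenvaluesOn, Set.mem_ofPred_eq, Set.mem_neg, LinearMap.neg_apply, Complex.ofReal_neg,
    neg_smul, neg_eq_iff_eq_neg]

theorem lambdaMin_eq_neg (W : Submodule ℂ V) (T : V →ₗ[ℂ] V) :
    lambdaMin W T = -lambdaMax W (-T) := by
  rw [lambdaMin, lambdaMax, eigenvaluesOn_neg, Real.sInf_def]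

theorem isLeast_neg_of_isGreatest {s : Set ℝ} {a : ℝ} (h : IsGreatest (-s) a) :
    IsLeast s (-a) :=
  ⟨h.1, fun x hx => by
    have := h.2 (show -x ∈ -s by simpa using hx)
    linarith⟩

end Spectral

/-! ### The operators `onFirst` and `levelOp`. -/

section Level

variable {E : Type*} [NormedAddCommGroup E] [InnerProductSpace ℂ E]
variable {ι : Type*} [Fintype ι]

theorem valuesOn_neg (X : Set (E →L[ℂ] E)) (H : E →ₗ[ℂ] E) :
    valuesOn X (-H) = -valuesOn X H := by
  ext r
  simp only [valuesOn, Set.mem_ofPred_eq, Set.mem_neg, LinearMap.neg_apply, inner_neg_right,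
    Complex.neg_re, neg_eq_iff_eq_neg]

theorem minOn_eq_neg (X : Set (E →L[ℂ] E)) (H : E →ₗ[ℂ] E) :
    minOn X H = -maxOn X (-H) := by
  rw [minOn, maxOn, valuesOn_neg, Real.sInf_def]

theorem sum_cons {k : ℕ} {M : Type*} [AddCommMonoid M] (f : (Fin (k + 1) → ι) → M) :
    ∑ i, f i = ∑ a, ∑ i : Fin k → ι, f (Fin.cons a i) := by
  rw [← (Fin.consEquiv fun _ => ι).sum_comp, Fintype.sum_prod_type]
  rfl

theorem sum_snoc {k : ℕ} {M : Type*} [AddCommMonoid M] (f : (Fin (k + 1) → ι) → M) :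
    ∑ i, f i = ∑ a, ∑ i : Fin k → ι, f (Fin.snoc i a) := by
  rw [← (Fin.snocEquiv fun _ => ι).sum_comp, Fintype.sum_prod_type]
  rfl

theorem norm_productTensor (b : OrthonormalBasis ι ℂ E) {k : ℕ} (φ : Fin k → E) : ‖productTensor b φ‖ = ∏ j, ‖φ j‖ := by
  have h := inner_productTensor b φ φ
  simp only [inner_self_eq_norm_sq_to_K, Finset.prod_pow] at h
  norm_cast at h
  exact (pow_left_inj₀ (norm_nonneg _) (Finset.prod_nonneg fun _ _ => norm_nonneg _) two_ne_zero).1 h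

variable [DecidableEq ι] (b : OrthonormalBasis ι ℂ E)

theorem onFirst_apply_cons {k : ℕ} (H : E →ₗ[ℂ] E) (v : Tensors ι (k + 1)) (a : ι)
    (i : Fin k → ι) :
    onFirst b (k + 1) H v (Fin.cons a i) = ∑ c, ⟪b a, H (b c)⟫_ℂ * v (Fin.cons c i) := by
  simp only [onFirst, tensorOp, Matrix.toEuclideanLin, Matrix.toLpLin_apply, Matrix.mulVec,
    dotProduct, Matrix.of_apply, sum_cons, Fin.prod_univ_succ, Fin.cons_zero, Fin.cons_succ]
  refine Finset.sum_congr rfl fun c _ => ?_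
  rw [Finset.sum_eq_single i]
  · simp
  · intro j _ hj
    obtain ⟨t, ht⟩ := Function.ne_iff.1 hj
    have : ∏ t, ⟪b (i t), (if ((t.succ : Fin (k + 1)) : ℕ) = 0 then H else LinearMap.id) (b (j t))⟫_ℂ
        = 0 := Finset.prod_eq_zero (Finset.mem_univ t) (by simp [b.inner_eq_ite, ht.symm])
    rw [this]; simp
  · simp

/-- The inner sum is the one-particle reduced matrix of $wv^*$: only this matrix matters for an
operator acting on the first factor. -/
theorem inner_onFirst {k : ℕ} (H : E →ₗ[ℂ] E) (v w : Tensors ι (k + 1)) :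
    ⟪v, onFirst b (k + 1) H w⟫_ℂ = ∑ a, ∑ c, ⟪b a, H (b c)⟫_ℂ *
      ∑ i : Fin k → ι, w (Fin.cons c i) * star (v (Fin.cons a i)) := by
  rw [PiLp.inner_apply, sum_cons]
  refine Finset.sum_congr rfl fun a _ => ?_
  simp only [onFirst_apply_cons, RCLike.inner_apply, Finset.sum_mul, Finset.mul_sum]
  rw [Finset.sum_comm]
  simp [mul_assoc]

theorem onFirst_isSymmetric {k : ℕ} {H : E →ₗ[ℂ] E} (hH : H.IsSymmetric) :
    (onFirst b k H).IsSymmetric := by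
  unfold onFirst tensorOp
  rw [Matrix.isSymmetric_toEuclideanLin_iff]
  ext i j
  simp only [Matrix.conjTranspose_apply, Matrix.of_apply, star_prod]
  refine Finset.prod_congr rfl fun t _ => ?_
  have : (if (t : ℕ) = 0 then H else LinearMap.id).IsSymmetric := by
    split_ifs
    · exact hH
    · exact fun _ _ => rfl
  rw [← this]
  exact inner_conj_symm _ _

/-- At `k = 0` the operator is an empty product, equal to 1 for every `H`, so the sign rule starts
at `k = 1`. -/
theorem onFirst_neg {k : ℕ} (hk : 1 ≤ k) (H : E →ₗ[ℂ] E) :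
    onFirst b k (-H) = -onFirst b k H := by
  obtain ⟨k, rfl⟩ := Nat.exists_eq_add_of_le' hk
  ext v i
  rw [← Fin.cons_self_tail i]
  simp only [onFirst_apply_cons, LinearMap.neg_apply, PiLp.neg_apply, inner_neg_right, neg_mul,
    Finset.sum_neg_distrib]

variable {k : ℕ} (W : Submodule ℂ (Tensors ι k))

theorem levelOp_neg (hk : 1 ≤ k) (H : E →ₗ[ℂ] E) :
    levelOp b W (-H) = -levelOp b W H := by
  simp only [levelOp, onFirst_neg b hk, LinearMap.comp_neg, LinearMap.neg_comp]

theorem levelOp_mem (H : E →ₗ[ℂ] E) (v : Tensors ι k) : levelOp b W H v ∈ W :=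
  W.starProjection_apply_mem _

theorem levelOp_isSymmetric {H : E →ₗ[ℂ] E} (hH : H.IsSymmetric) :
    (levelOp b W H).IsSymmetric := by
  intro v w
  simp only [levelOp, LinearMap.comp_apply, ContinuousLinearMap.coe_coe]
  rw [Submodule.inner_starProjection_left_eq_right, onFirst_isSymmetric b hH,
    Submodule.inner_starProjection_left_eq_right]

theorem inner_levelOp (H : E →ₗ[ℂ] E) {v : Tensors ι k} (hv : v ∈ W) :
    ⟪v, levelOp b W H v⟫_ℂ = ⟪v, onFirst b k H v⟫_ℂ := by
  simp only [levelOp, LinearMap.comp_apply, ContinuousLinearMap.coe_coe]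
  rw [← Submodule.inner_starProjection_left_eq_right,
    Submodule.starProjection_eq_self_iff.2 hv]

theorem inner_onFirst_productTensor (hk : 1 ≤ k) (H : E →ₗ[ℂ] E) {ψ : E} (hψ : ‖ψ‖ = 1) :
    ⟪productTensor b fun _ : Fin k => ψ, onFirst b k H (productTensor b fun _ => ψ)⟫_ℂ
      = ⟪ψ, H ψ⟫_ℂ := by
  obtain ⟨k, rfl⟩ := Nat.exists_eq_add_of_le' hk
  rw [onFirst, tensorOp_productTensor, inner_productTensor, Fin.prod_univ_succ]
  simp [inner_self_eq_norm_sq_to_K, hψ]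

end Level
end XTangle

namespace XTangle
open Filter Topology

/-! ### Symmetric tensors, polynomials and contraction. -/

section Duality

variable {ι : Type*} {k : ℕ}

/-- The tensor with its factors permuted. -/
def permute (σ : Equiv.Perm (Fin k)) (t : Tensors ι k) : Tensors ι k :=
  WithLp.toLp 2 fun i => t (i ∘ σ)

@[simp] theorem permute_apply (σ : Equiv.Perm (Fin k)) (t : Tensors ι k) (i : Fin k → ι) :
    permute σ t i = t (i ∘ σ) := rfl

/-- The symmetrization of a tensor. -/
noncomputable def symmetrize (t : Tensors ι k) : Tensors ι k :=
  (Nat.factorial k : ℂ)⁻¹ • ∑ σ : Equiv.Perm (Fin k), permute σ t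

/-- The slice of a tensor at the index `a` of the first factor. -/
def headSlice (v : Tensors ι (k + 1)) (a : ι) : Tensors ι k :=
  WithLp.toLp 2 fun i => v (Fin.cons a i)

@[simp] theorem headSlice_apply (v : Tensors ι (k + 1)) (a : ι) (i : Fin k → ι) :
    headSlice v a i = v (Fin.cons a i) := rfl

/-- The slice of a tensor at the index `a` of the last factor. -/
def lastSlice (v : Tensors ι (k + 1)) (a : ι) : Tensors ι k :=
  WithLp.toLp 2 fun i => v (Fin.snoc i a)

@[simp] theorem lastSlice_apply (v : Tensors ι (k + 1)) (a : ι) (i : Fin k → ι) :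
    lastSlice v a i = v (Fin.snoc i a) := rfl

theorem apply_snoc_of_mem_symTensors {v : Tensors ι (k + 1)} (hv : v ∈ symTensors ι (k + 1))
    (i : Fin k → ι) (a : ι) : v (Fin.snoc i a) = v (Fin.cons a i) := by
  rw [Fin.snoc_eq_cons_rotate]
  exact hv (finRotate _) (Fin.cons a i)

/-- The tensor `e_a ⊗ t`. -/
def consTensor [DecidableEq ι] (a : ι) (t : Tensors ι k) : Tensors ι (k + 1) :=
  WithLp.toLp 2 fun i => if i 0 = a then t (Fin.tail i) else 0

theorem consTensor_apply_cons [DecidableEq ι] (a c : ι) (t : Tensors ι k) (i : Fin k → ι) :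
    consTensor a t (Fin.cons c i) = if c = a then t i else 0 := by
  simp [consTensor]

theorem symmetrize_apply (t : Tensors ι k) (i : Fin k → ι) :
    symmetrize t i = (Nat.factorial k : ℂ)⁻¹ * ∑ σ : Equiv.Perm (Fin k), t (i ∘ σ) := by
  simp [symmetrize]

theorem symmetrize_mem (t : Tensors ι k) : symmetrize t ∈ symTensors ι k := by
  intro σ i
  rw [symmetrize_apply, symmetrize_apply]
  congr 1
  exact Fintype.sum_equiv (Equiv.mulLeft σ) _ _ fun τ => rfl

/-- A hierarchy of spaces of symmetric tensors that is closed under contraction. -/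
structure IsContractive (W : (k : ℕ) → Submodule ℂ (Tensors ι k)) : Prop where
  le_symTensors : ∀ k, W k ≤ symTensors ι k
  headSlice_mem : ∀ {k} {v : Tensors ι (k + 1)}, v ∈ W (k + 1) → ∀ a, headSlice v a ∈ W k

theorem IsContractive.lastSlice_mem {W : (k : ℕ) → Submodule ℂ (Tensors ι k)}
    (hW : IsContractive W) {k : ℕ} {v : Tensors ι (k + 1)} (hv : v ∈ W (k + 1)) (a : ι) :
    lastSlice v a ∈ W k := by
  convert hW.headSlice_mem hv a
  ext i
  exact apply_snoc_of_mem_symTensors (hW.le_symTensors _ hv) i a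

theorem headSlice_mem_symTensors {v : Tensors ι (k + 1)} (hv : v ∈ symTensors ι (k + 1)) (a : ι) :
    headSlice v a ∈ symTensors ι k := by
  intro σ i
  -- `decomposeFin.symm (0, σ)` extends `σ` to all factors by fixing the first.
  have h : (Fin.cons a (i ∘ σ) : Fin (k + 1) → ι)
      = Fin.cons a i ∘ Equiv.Perm.decomposeFin.symm (0, σ) := by
    funext j
    refine Fin.cases ?_ (fun j => ?_) j <;> simp
  rw [headSlice_apply, headSlice_apply, h]
  exact hv _ _

variable [Fintype ι]

theorem tensorPoly_apply (t : Tensors ι k) :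
    tensorPoly k t = ∑ i, t i • ∏ j, (MvPolynomial.X (i j) : MvPolynomial ι ℂ) := by
  simp [tensorPoly, Fintype.linearCombination_apply]

theorem sum_comp_perm {M : Type*} [AddCommMonoid M] (σ : Equiv.Perm (Fin k))
    (f : (Fin k → ι) → M) : ∑ i, f (i ∘ σ) = ∑ i, f i :=
  (Equiv.arrowCongr σ.symm (Equiv.refl ι)).sum_comp f

theorem tensorPoly_permute (σ : Equiv.Perm (Fin k)) (t : Tensors ι k) :
    tensorPoly k (permute σ t) = tensorPoly k t := by
  rw [tensorPoly_apply, tensorPoly_apply, ← sum_comp_perm σ fun i => t i • _]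
  refine Finset.sum_congr rfl fun i _ => ?_
  rw [permute_apply]
  congr 1
  exact (Equiv.prod_comp σ fun j => (MvPolynomial.X (i j) : MvPolynomial ι ℂ)).symm

theorem tensorPoly_symmetrize (t : Tensors ι k) :
    tensorPoly k (symmetrize t) = tensorPoly k t := by
  have h : (Nat.factorial k : ℂ) ≠ 0 := by exact_mod_cast Nat.factorial_ne_zero k
  simp only [symmetrize, map_smul, map_sum, tensorPoly_permute, Finset.sum_const,
    Finset.card_univ, Fintype.card_perm, Fintype.card_fin]
  rw [← Nat.cast_smul_eq_nsmul ℂ, inv_smul_smul₀ h]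

theorem sum_symmetrize_mul (t : Tensors ι k) {v : Tensors ι k} (hv : v ∈ symTensors ι k) :
    ∑ i, symmetrize t i * v i = ∑ i, t i * v i := by
  have h : (Nat.factorial k : ℂ) ≠ 0 := by exact_mod_cast Nat.factorial_ne_zero k
  have hσ : ∀ σ : Equiv.Perm (Fin k), ∑ i, t (i ∘ σ) * v i = ∑ i, t i * v i := fun σ => by
    rw [← sum_comp_perm σ fun i => t i * v i]
    exact Finset.sum_congr rfl fun i _ => by rw [hv σ i]
  simp only [symmetrize_apply, Finset.mul_sum, Finset.sum_mul]
  rw [Finset.sum_comm]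
  simp only [mul_assoc, ← Finset.mul_sum, hσ]
  rw [Finset.sum_const, Finset.card_univ, Fintype.card_perm, Fintype.card_fin, nsmul_eq_mul,
    inv_mul_cancel_left₀ h]

/-- Symmetrizing `t` changes neither its polynomial nor its pairing with a symmetric tensor, so the
test tensors need not be symmetric. This allows testing against $e_a\otimes t$. -/
theorem mem_idealPerp_iff {I : Ideal (MvPolynomial ι ℂ)} {v : Tensors ι k} :
    v ∈ idealPerp I k ↔
      v ∈ symTensors ι k ∧ ∀ t : Tensors ι k, tensorPoly k t ∈ I → ∑ i, t i * v i = 0 := by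
  refine ⟨fun h => ⟨h.1, fun t ht => ?_⟩, fun h => ⟨h.1, fun t ht => h.2 t ht.2⟩⟩
  rw [← sum_symmetrize_mul t h.1]
  refine h.2 _ ⟨symmetrize_mem t, ?_⟩
  change tensorPoly k (symmetrize t) ∈ I
  rwa [tensorPoly_symmetrize]

theorem tensorPoly_consTensor [DecidableEq ι] (a : ι) (t : Tensors ι k) :
    tensorPoly (k + 1) (consTensor a t) = MvPolynomial.X a * tensorPoly k t := by
  simp only [tensorPoly_apply, sum_cons, consTensor_apply_cons, Fin.prod_univ_succ, Fin.cons_zero,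
    Fin.cons_succ, ite_smul, zero_smul]
  rw [Finset.sum_comm]
  simp [Finset.mul_sum]

theorem sum_consTensor_mul [DecidableEq ι] (a : ι) (t : Tensors ι k) (v : Tensors ι (k + 1)) :
    ∑ i, consTensor a t i * v i = ∑ i, t i * headSlice v a i := by
  simp only [sum_cons, consTensor_apply_cons]
  rw [Finset.sum_comm]
  simp

/-- Slicing is the transpose of $t\mapsto e_a\otimes t$, which on polynomials is multiplication by
$x_a$ and preserves the ideal. -/
theorem headSlice_mem_idealPerp {I : Ideal (MvPolynomial ι ℂ)} {v : Tensors ι (k + 1)}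
    (hv : v ∈ idealPerp I (k + 1)) (a : ι) : headSlice v a ∈ idealPerp I k := by
  classical
  rw [mem_idealPerp_iff] at hv ⊢
  refine ⟨headSlice_mem_symTensors hv.1 a, fun t ht => ?_⟩
  rw [← sum_consTensor_mul]
  refine hv.2 _ ?_
  rw [tensorPoly_consTensor]
  exact I.mul_mem_left _ ht

theorem homogeneousSubmodule_le_range_tensorPoly (k : ℕ) :
    MvPolynomial.homogeneousSubmodule ι ℂ k ≤ LinearMap.range (tensorPoly (ι := ι) k) := by
  classical
  induction k with
  | zero =>
    rw [MvPolynomial.homogeneousSubmodule_zero, Submodule.one_le]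
    refine ⟨WithLp.toLp 2 fun _ => 1, ?_⟩
    simp [tensorPoly_apply]
  | succ k ih =>
    rw [← MvPolynomial.homogeneousSubmodule_one_pow, pow_succ',
      MvPolynomial.homogeneousSubmodule_one_pow, Submodule.mul_le]
    intro x hx y hy
    obtain ⟨t, rfl⟩ := ih hy
    rw [MvPolynomial.homogeneousSubmodule_one_eq_span_X] at hx
    induction hx using Submodule.span_induction with
    | mem x h =>
      obtain ⟨a, rfl⟩ := h
      exact ⟨consTensor a t, tensorPoly_consTensor a t⟩
    | zero => simp
    | add x y _ _ hx hy => rw [add_mul]; exact add_mem hx hy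
    | smul c x _ hx => rw [smul_mul_assoc]; exact Submodule.smul_mem _ c hx

end Duality

/-! ### Points of the variety as product tensors in the hierarchy. -/

section Variety

variable {E : Type*} [NormedAddCommGroup E] [InnerProductSpace ℂ E]
variable {ι : Type*} [Fintype ι] (b : OrthonormalBasis ι ℂ E) {I : Ideal (MvPolynomial ι ℂ)}

theorem productTensor_mem_symTensors {k : ℕ} (ψ : E) :
    (productTensor b fun _ : Fin k => ψ) ∈ symTensors ι k := by
  intro σ i
  exact Equiv.prod_comp σ fun j => b.repr ψ (i j)

/-- Evaluating at `ψ` the polynomial of a tensor is pairing the tensor with $\psi^{\otimes k}$.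
Homogeneity of `I` keeps each homogeneous component of `f` in `I`, and each component comes from a
tensor. -/
theorem forall_eval_eq_zero_iff (hI : I.IsHomogeneous (MvPolynomial.homogeneousSubmodule ι ℂ))
    (ψ : E) :
    (∀ f ∈ I, MvPolynomial.eval (fun a => b.repr ψ a) f = 0) ↔
      ∀ k, (productTensor b fun _ : Fin k => ψ) ∈ idealPerp I k := by
  refine ⟨fun h k => mem_idealPerp_iff.2 ⟨productTensor_mem_symTensors b ψ, fun t ht => ?_⟩,
    fun h f hf => ?_⟩
  · rw [← eval_tensorPoly]
    exact h _ ht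
  · rw [← MvPolynomial.sum_homogeneousComponent f, map_sum]
    refine Finset.sum_eq_zero fun k _ => ?_
    obtain ⟨t, ht⟩ := homogeneousSubmodule_le_range_tensorPoly k
      (MvPolynomial.homogeneousComponent_mem k f)
    rw [← ht, eval_tensorPoly]
    refine (mem_idealPerp_iff.1 (h k)).2 t ?_
    rw [ht]
    exact MvPolynomial.homogeneousComponent_mem_of_mem hI hf k

theorem productTensor_smul {k : ℕ} (c : ℂ) (ψ : E) :
    (productTensor b fun _ : Fin k => c • ψ) = c ^ k • productTensor b fun _ : Fin k => ψ := by
  ext i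
  simp [productTensor, Finset.prod_mul_distrib]

/-- A pure state determines its vector only up to a phase, so membership in the variety has to be
transported along scalar multiples. -/
theorem pureState_eq_iff_of_norm_eq_one {ψ χ : E} (hχ : ‖χ‖ = 1) (h : pureState ψ = pureState χ) :
    ‖ψ‖ = 1 ∧ ∃ c : ℂ, ψ = c • χ := by
  have hn : ‖ψ‖ = 1 := by
    have := congrArg norm h
    simp only [pureState, InnerProductSpace.norm_rankOne, hχ, mul_one] at this
    nlinarith [norm_nonneg ψ]
  refine ⟨hn, ⟪χ, ψ⟫_ℂ, ?_⟩
  have := congrArg (fun T => T ψ) h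
  simpa [pureState, inner_self_eq_norm_sq_to_K, hn] using this

theorem pureState_mem_variety_iff
    (hI : I.IsHomogeneous (MvPolynomial.homogeneousSubmodule ι ℂ)) {ψ : E} :
    pureState ψ ∈ variety b I ↔
      ‖ψ‖ = 1 ∧ ∀ k, (productTensor b fun _ : Fin k => ψ) ∈ idealPerp I k := by
  constructor
  · rintro ⟨χ, hχ, h0, h⟩
    obtain ⟨hn, c, rfl⟩ := pureState_eq_iff_of_norm_eq_one hχ h
    refine ⟨hn, fun k => ?_⟩
    rw [productTensor_smul]
    exact Submodule.smul_mem _ _ ((forall_eval_eq_zero_iff b hI χ).1 h0 k)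
  · rintro ⟨hn, h⟩
    exact ⟨ψ, hn, (forall_eval_eq_zero_iff b hI ψ).2 h, rfl⟩

theorem varietyPower_le_idealPerp (hI : I.IsHomogeneous (MvPolynomial.homogeneousSubmodule ι ℂ))
    (k : ℕ) : varietyPower b (variety b I) k ≤ idealPerp I k := by
  refine Submodule.span_le.2 ?_
  rintro _ ⟨ψ, hψ, rfl⟩
  exact ((pureState_mem_variety_iff b hI).1 hψ).2 k

theorem headSlice_mem_varietyPower {X : Set (E →L[ℂ] E)} {k : ℕ} {v : Tensors ι (k + 1)}
    (hv : v ∈ varietyPower b X (k + 1)) (a : ι) : headSlice v a ∈ varietyPower b X k := by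
  induction hv using Submodule.span_induction with
  | mem x h =>
    obtain ⟨ψ, hψ, rfl⟩ := h
    have : headSlice (productTensor b fun _ : Fin (k + 1) => ψ) a
        = b.repr ψ a • productTensor b fun _ : Fin k => ψ := by
      ext i
      simp [productTensor, Fin.prod_univ_succ]
    rw [this]
    exact Submodule.smul_mem _ _ (Submodule.subset_span ⟨ψ, hψ, rfl⟩)
  | zero => exact zero_mem _
  | add x y _ _ hx hy => exact add_mem hx hy
  | smul c x _ hx => exact Submodule.smul_mem _ c hx

theorem isContractive_idealPerp (I : Ideal (MvPolynomial ι ℂ)) : IsContractive (idealPerp I) :=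
  ⟨fun _ _ h => h.1, headSlice_mem_idealPerp⟩

theorem isContractive_varietyPower
    (X : Set (E →L[ℂ] E)) : IsContractive (varietyPower b X) := by
  refine ⟨fun k => Submodule.span_le.2 ?_, headSlice_mem_varietyPower b⟩
  rintro _ ⟨ψ, -, rfl⟩
  exact productTensor_mem_symTensors b ψ

/-- All that the convergence argument needs to know about `X`. For `W k` $=X^k$ the converse
direction uses $X^k\subseteq I_k^\perp$. -/
theorem pureState_mem_iff (hI : I.IsHomogeneous (MvPolynomial.homogeneousSubmodule ι ℂ))
    {W : (k : ℕ) → Submodule ℂ (Tensors ι k)}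
    (hW : W = idealPerp I ∨ W = varietyPower b (variety b I)) {ψ : E} :
    pureState ψ ∈ variety b I ↔
      ‖ψ‖ = 1 ∧ ∀ k, (productTensor b fun _ : Fin k => ψ) ∈ W k := by
  rcases hW with rfl | rfl
  · exact pureState_mem_variety_iff b hI
  · refine ⟨fun h => ⟨((pureState_mem_variety_iff b hI).1 h).1,
      fun k => Submodule.subset_span ⟨ψ, h, rfl⟩⟩, fun h => ?_⟩
    exact (pureState_mem_variety_iff b hI).2
      ⟨h.1, fun k => varietyPower_le_idealPerp b hI k (h.2 k)⟩

end Variety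
end XTangle

namespace XTangle
open Filter Topology
open scoped ComplexOrder

/-! ### Two facts on complex matrices. -/

section PosSemidef

variable {n : Type*} [Fintype n]

/-- Nonnegativity of the $2\times2$ minors gives $|M_{ij}|^2\le M_{ii}M_{jj}$, and each diagonal
entry is at most the trace. -/
theorem norm_apply_le_trace {M : Matrix n n ℂ} (hM : M.PosSemidef) (i j : n) :
    ‖M i j‖ ≤ M.trace.re := by
  have hd : ∀ i, 0 ≤ (M i i).re ∧ (M i i).im = 0 := fun i => by
    have := Complex.le_def.1 (hM.diag_nonneg (i := i))
    exact ⟨by simpa using this.1, by simpa using this.2.symm⟩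
  have ht : ∀ i, (M i i).re ≤ M.trace.re := fun i => by
    rw [Matrix.trace, Complex.re_sum]
    exact Finset.single_le_sum (f := fun i => (M.diag i).re) (fun i _ => (hd i).1)
      (Finset.mem_univ i)
  have h := (hM.submatrix ![i, j]).det_nonneg
  have hji : M j i = star (M i j) := (hM.1.apply j i).symm
  rw [Matrix.det_fin_two] at h
  simp only [Matrix.submatrix_apply, Matrix.cons_val_zero, Matrix.cons_val_one, hji] at h
  have h1 := (Complex.le_def.1 h).1
  simp only [Complex.sub_re, Complex.mul_re, (hd i).2, (hd j).2, Complex.star_def, Complex.conj_re,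
    Complex.conj_im, Complex.zero_re] at h1
  have h2 : ‖M i j‖ ^ 2 = (M i j).re * (M i j).re + (M i j).im * (M i j).im := by
    rw [← Complex.normSq_eq_norm_sq, Complex.normSq_apply]
  refine abs_le_of_sq_le_sq' (a := ‖M i j‖) ?_ ((hd i).1.trans (ht i)) |>.2
  nlinarith [mul_le_mul (ht i) (ht j) (hd j).1 ((hd i).1.trans (ht i))]

theorem eq_zero_of_forall_sum_eq_zero {M : n → n → ℂ}
    (h : ∀ φ : n → ℂ, ∑ a, ∑ c, star (φ a) * φ c * M a c = 0) (a c : n) : M a c = 0 := by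
  classical
  have h0 : Matrix.toEuclideanLin (Matrix.of M) = 0 := by
    rw [← inner_map_self_eq_zero]
    intro x
    rw [← inner_conj_symm]
    have := h x
    rw [PiLp.inner_apply]
    simp only [RCLike.inner_apply, Matrix.toLpLin_apply, Matrix.mulVec, dotProduct,
      Matrix.of_apply, Finset.sum_mul]
    rw [← map_zero (starRingEnd ℂ), ← this]
    congr 1
    refine Finset.sum_congr rfl fun a _ => Finset.sum_congr rfl fun c _ => ?_
    rw [Complex.star_def]
    ring
  have h1 : Matrix.of M = 0 := by simpa using h0
  exact congrFun (congrFun h1 a) c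

end PosSemidef

/-! ### Exchangeable families and their extreme points. -/

variable {ι : Type*} [Fintype ι]

/-- Kernels on all tensor powers. -/
abbrev TensorKernels (ι : Type*) : Type _ := (k : ℕ) → (Fin k → ι) → (Fin k → ι) → ℂ

/-- Compatible families of positive operators, the `k`-th one having its range in `W k`. -/
structure IsExchangeable (W : (k : ℕ) → Submodule ℂ (Tensors ι k)) (ρ : TensorKernels ι) :
    Prop where
  posSemidef : ∀ k, (Matrix.of (ρ k)).PosSemidef
  column_mem : ∀ k j, WithLp.toLp 2 (fun i => ρ k i j) ∈ W k
  sum_snoc : ∀ k i j, ∑ a, ρ (k + 1) (Fin.snoc i a) (Fin.snoc j a) = ρ k i j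

/-- The total mass of a family of kernels. -/
def mass (ρ : TensorKernels ι) : ℂ := ρ 0 default default

theorem sum_diag_eq_mass {ρ : TensorKernels ι} {k : ℕ}
    (h : ∀ l < k, ∀ i j, ∑ a, ρ (l + 1) (Fin.snoc i a) (Fin.snoc j a) = ρ l i j) :
    ∑ i, ρ k i i = mass ρ := by
  induction k with
  | zero => rw [Fintype.sum_unique]; rfl
  | succ k ih =>
    rw [sum_snoc, Finset.sum_comm, ← ih fun l hl => h l (by omega)]
    exact Finset.sum_congr rfl fun i _ => h k (by omega) i i

/-- The family of kernels obtained by contracting the first factor with the vector `φ`. -/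
def condition (φ : ι → ℂ) (ρ : TensorKernels ι) : TensorKernels ι :=
  fun k i j => ∑ a, ∑ c, star (φ a) * φ c * ρ (k + 1) (Fin.cons a i) (Fin.cons c j)

namespace IsExchangeable

variable {W : (k : ℕ) → Submodule ℂ (Tensors ι k)} {ρ σ : TensorKernels ι}

theorem star_apply (h : IsExchangeable W ρ) {k : ℕ} (i j : Fin k → ι) :
    star (ρ k i j) = ρ k j i := (h.posSemidef k).1.apply j i

theorem trace_eq (h : IsExchangeable W ρ) (k : ℕ) : ∑ i, ρ k i i = mass ρ :=
  sum_diag_eq_mass fun l _ => h.sum_snoc l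

theorem norm_apply_le (h : IsExchangeable W ρ) {k : ℕ} (i j : Fin k → ι) :
    ‖ρ k i j‖ ≤ (mass ρ).re := by
  rw [← h.trace_eq k]
  exact norm_apply_le_trace (h.posSemidef k) i j

theorem mass_nonneg (h : IsExchangeable W ρ) : 0 ≤ mass ρ :=
  (h.posSemidef 0).diag_nonneg

theorem ofReal_mass_re (h : IsExchangeable W ρ) : ((mass ρ).re : ℂ) = mass ρ :=
  (Complex.eq_re_of_ofReal_le (r := 0) (by simpa using h.mass_nonneg)).symm

theorem eq_zero_of_mass (h : IsExchangeable W ρ) (h0 : (mass ρ).re = 0) : ρ = 0 := by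
  funext k i j
  have := h.norm_apply_le i j
  rw [h0] at this
  exact norm_le_zero_iff.1 this

theorem add (h : IsExchangeable W ρ) (h' : IsExchangeable W σ) : IsExchangeable W (ρ + σ) where
  posSemidef k := (h.posSemidef k).add (h'.posSemidef k)
  column_mem k j := (W k).add_mem (h.column_mem k j) (h'.column_mem k j)
  sum_snoc k i j := by
    simp only [Pi.add_apply, Finset.sum_add_distrib, h.sum_snoc, h'.sum_snoc]

theorem zero : IsExchangeable W (0 : TensorKernels ι) where
  posSemidef _ := Matrix.PosSemidef.zero
  column_mem k _ := (W k).zero_mem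
  sum_snoc k i j := by simp

theorem sum {α : Type*} (s : Finset α) {σ : α → TensorKernels ι}
    (h : ∀ x ∈ s, IsExchangeable W (σ x)) : IsExchangeable W (∑ x ∈ s, σ x) :=
  Finset.sum_induction _ _ (fun _ _ => add) zero h

theorem smul (h : IsExchangeable W ρ) {r : ℝ} (hr : 0 ≤ r) : IsExchangeable W (r • ρ) where
  posSemidef k := (h.posSemidef k).smul hr
  column_mem k j := (W k).smul_mem (r : ℂ) (h.column_mem k j)
  sum_snoc k i j := by
    simp only [Pi.smul_apply, ← Finset.smul_sum, h.sum_snoc]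

/-- Columns are symmetric tensors, and so are rows by Hermiticity; the traced factor can therefore
be moved from the last place to the first. -/
theorem sum_cons (hW : IsContractive W) (h : IsExchangeable W ρ) {k : ℕ} (i j : Fin k → ι) :
    ∑ a, ρ (k + 1) (Fin.cons a i) (Fin.cons a j) = ρ k i j := by
  rw [← h.sum_snoc]
  refine Finset.sum_congr rfl fun a _ => ?_
  have hs := fun i' j' => apply_snoc_of_mem_symTensors (hW.le_symTensors _ (h.column_mem (k + 1) j'))
    i' a
  have h1 := hs i (Fin.cons a j)
  have h2 := hs j (Fin.snoc i a)
  simp only at h1 h2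
  rw [← h1, ← h.star_apply, ← h2, h.star_apply]

theorem condition (hW : IsContractive W) (h : IsExchangeable W ρ) (φ : ι → ℂ) :
    IsExchangeable W (condition φ ρ) where
  posSemidef k := by
    classical
    -- `V` is $\varphi\otimes 1$, and conditioning is $\rho_{k+1}\mapsto V^*\rho_{k+1}V$.
    let V : Matrix (Fin (k + 1) → ι) (Fin k → ι) ℂ :=
      Matrix.of fun i j => if Fin.tail i = j then φ (i 0) else 0
    have := (h.posSemidef (k + 1)).conjTranspose_mul_mul_same V
    convert this
    ext i j
    simp only [Matrix.mul_apply, XTangle.sum_cons, V, Matrix.conjTranspose_apply, Matrix.of_apply,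
      Fin.tail_cons, Fin.cons_zero]
    simp only [XTangle.condition, apply_ite star, star_zero, ite_mul, zero_mul, mul_ite, mul_zero,
      Finset.sum_ite_eq', Finset.mem_univ, if_true, Finset.sum_mul]
    rw [Finset.sum_comm]
    refine Finset.sum_congr rfl fun c _ => Finset.sum_congr rfl fun a _ => by ring
  column_mem k j := by
    have : WithLp.toLp 2 (fun i => XTangle.condition φ ρ k i j) = ∑ a, ∑ c, (star (φ a) * φ c) •
        headSlice (WithLp.toLp 2 fun i => ρ (k + 1) i (Fin.cons c j)) a := by
      ext i
      simp [XTangle.condition]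
    rw [this]
    exact sum_mem fun a _ => sum_mem fun c _ =>
      Submodule.smul_mem _ _ (hW.headSlice_mem (h.column_mem _ _) a)
  sum_snoc k i j := by
    simp only [XTangle.condition]
    rw [Finset.sum_comm]
    refine Finset.sum_congr rfl fun a _ => ?_
    rw [Finset.sum_comm]
    refine Finset.sum_congr rfl fun c _ => ?_
    simp only [Fin.cons_snoc_eq_snoc_cons, ← Finset.mul_sum, h.sum_snoc]

end IsExchangeable

/-- The exchangeable families of density operators. -/
def exchangeableStates (W : (k : ℕ) → Submodule ℂ (Tensors ι k)) : Set (TensorKernels ι) :=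
  {ρ | IsExchangeable W ρ ∧ mass ρ = 1}

variable {W : (k : ℕ) → Submodule ℂ (Tensors ι k)} {ρ σ τ : TensorKernels ι}

theorem smul_mem_exchangeableStates (h : IsExchangeable W ρ) (h0 : 0 < (mass ρ).re) :
    (mass ρ).re⁻¹ • ρ ∈ exchangeableStates W := by
  refine ⟨h.smul (inv_nonneg.2 h0.le), ?_⟩
  change (mass ρ).re⁻¹ • mass ρ = 1
  rw [← h.ofReal_mass_re, Complex.ofReal_re, Complex.real_smul, ← Complex.ofReal_mul,
    inv_mul_cancel₀ h0.ne', Complex.ofReal_one]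

/-- After normalization `ρ` is a convex combination of two states, both equal to `ρ` by extremality.
A summand of mass zero vanishes, since mass bounds all entries. -/
theorem eq_mass_smul_of_mem_extremePoints (hρ : ρ ∈ (exchangeableStates W).extremePoints ℝ)
    (hσ : IsExchangeable W σ) (hτ : IsExchangeable W τ) (h : σ + τ = ρ) :
    σ = (mass σ).re • ρ := by
  obtain ⟨hmem, hext⟩ := mem_extremePoints.1 hρ
  have hm : (mass σ).re + (mass τ).re = 1 := by
    rw [← Complex.add_re, ← Complex.one_re, ← hmem.2, ← h]
    rfl
  rcases (Complex.le_def.1 hσ.mass_nonneg).1.eq_or_lt with h0 | h0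
  · rw [hσ.eq_zero_of_mass h0.symm]
    simp [mass]
  rcases (Complex.le_def.1 hτ.mass_nonneg).1.eq_or_lt with h1 | h1
  · have : τ = 0 := hτ.eq_zero_of_mass h1.symm
    have h2 : (mass σ).re = 1 := by rw [← hm, ← h1]; simp
    rw [h2, one_smul, ← h, this, add_zero]
  · rw [Complex.zero_re] at h0 h1
    have := (hext _ (smul_mem_exchangeableStates hσ h0) _ (smul_mem_exchangeableStates hτ h1)
      ⟨_, _, h0, h1, hm, by rw [smul_inv_smul₀ h0.ne', smul_inv_smul₀ h1.ne', h]⟩).1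
    rw [← this, smul_inv_smul₀ h0.ne']

/-- Conditioning on `φ` and on its orthogonal complement splits `ρ`, up to positive factors, into
two exchangeable families; extremality makes the first proportional to `ρ`. -/
theorem condition_eq_mass_smul (hW : IsContractive W)
    (hρ : ρ ∈ (exchangeableStates W).extremePoints ℝ) (φ : ι → ℂ) :
    condition φ ρ = (mass (condition φ ρ)).re • ρ := by
  classical
  set n : ℝ := ∑ a, ‖φ a‖ ^ 2 with hn
  have hex : IsExchangeable W ρ := hρ.1.1
  rcases (show 0 ≤ n from Finset.sum_nonneg fun _ _ => by positivity).eq_or_lt with h0 | h0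
  · have hφ : ∀ a, φ a = 0 := fun a => by
      have := (Finset.sum_eq_zero_iff_of_nonneg (fun _ _ => by positivity)).1 h0.symm a
        (Finset.mem_univ a)
      simpa using this
    have : condition φ ρ = 0 := by
      funext k i j
      simp [condition, hφ]
    rw [this]
    simp [mass]
  -- With $n=\|\varphi\|^2$, $\beta_e$ is $n$ times the projection of $e_e$ onto $\varphi^\perp$.
  -- Hence $\sum_e\beta_e\beta_e^*=n^2\,1-n\,\varphi\varphi^*$, without choosing an orthonormal
  -- basis of $\varphi^\perp$.
  let β : ι → ι → ℂ := fun e a => (if a = e then (n : ℂ) else 0) - star (φ e) * φ a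
  have hβ : ∀ a c, ∑ e, star (β e a) * β e c
      = (if a = c then (n : ℂ) ^ 2 else 0) - n * (star (φ a) * φ c) := by
    intro a c
    have hnn : ∑ e, φ e * star (φ e) = n := by
      rw [hn]
      push_cast
      exact Finset.sum_congr rfl fun e _ => Complex.mul_conj' _
    have hexp : ∀ e, star (β e a) * β e c = (if a = e then (if c = e then (n : ℂ) ^ 2 else 0) else 0)
        - (if a = e then n * (star (φ e) * φ c) else 0)
        - (if c = e then n * (star (φ a) * φ e) else 0)
        + (φ e * star (φ e)) * (star (φ a) * φ c) := by
      intro e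
      have hs : star (n : ℂ) = n := Complex.conj_ofReal n
      simp only [β, star_sub, star_mul', star_star, apply_ite star, star_zero, hs]
      split_ifs <;> ring
    simp only [hexp, Finset.sum_add_distrib, Finset.sum_sub_distrib, ← Finset.sum_mul, hnn]
    simp only [Finset.sum_ite_eq, Finset.mem_univ, if_true, eq_comm (a := c) (b := a)]
    ring
  have hsum : n⁻¹ • condition φ ρ + (n ^ 2)⁻¹ • ∑ e, condition (β e) ρ = ρ := by
    have h1 : ∑ e, condition (β e) ρ = n ^ 2 • ρ - n • condition φ ρ := by
      funext k i j
      have hswap : (∑ e, condition (β e) ρ) k i j = ∑ a, ∑ c, (∑ e, star (β e a) * β e c) *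
          ρ (k + 1) (Fin.cons a i) (Fin.cons c j) := by
        simp only [Finset.sum_apply, condition, Finset.sum_mul]
        rw [Finset.sum_comm]
        exact Finset.sum_congr rfl fun a _ => Finset.sum_comm
      rw [hswap]
      simp only [hβ, sub_mul, Finset.sum_sub_distrib, ite_mul, zero_mul, Finset.sum_ite_eq,
        Finset.mem_univ, if_true, ← Finset.mul_sum, hex.sum_cons hW]
      simp [condition, Finset.mul_sum, mul_assoc]
    rw [h1, smul_sub, inv_smul_smul₀ (by positivity), smul_smul, sq, mul_inv, mul_assoc,
      inv_mul_cancel₀ h0.ne', mul_one]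
    abel
  have key := eq_mass_smul_of_mem_extremePoints hρ ((hex.condition hW φ).smul (inv_nonneg.2 h0.le))
    ((IsExchangeable.sum _ fun e _ => hex.condition hW (β e)).smul (by positivity)) hsum
  have hmass : (mass (n⁻¹ • condition φ ρ)).re = n⁻¹ * (mass (condition φ ρ)).re := by
    change (n⁻¹ • mass (condition φ ρ)).re = _
    simp
  rw [hmass, mul_smul] at key
  exact smul_right_injective _ (inv_ne_zero h0.ne') key

/-- The previous identity is an equality of quadratic forms in `φ`; over ℂ these determine the
matrix entries. -/
theorem apply_cons_of_mem_extremePoints (hW : IsContractive W)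
    (hρ : ρ ∈ (exchangeableStates W).extremePoints ℝ) {k : ℕ} (a c : ι) (i j : Fin k → ι) :
    ρ (k + 1) (Fin.cons a i) (Fin.cons c j) = ρ 1 (fun _ => a) (fun _ => c) * ρ k i j := by
  refine sub_eq_zero.1 (eq_zero_of_forall_sum_eq_zero (M := fun a c =>
    ρ (k + 1) (Fin.cons a i) (Fin.cons c j) - ρ 1 (fun _ => a) (fun _ => c) * ρ k i j)
    (fun φ => ?_) a c)
  have h := congrFun (congrFun (congrFun (condition_eq_mass_smul hW hρ φ) k) i) j
  simp only [Pi.smul_apply, Complex.real_smul, (hρ.1.1.condition hW φ).ofReal_mass_re] at h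
  have hc : ∀ a : ι, (Fin.cons a default : Fin 1 → ι) = fun _ => a := fun a => by
    funext t
    rw [Subsingleton.elim (α := Fin 1) t 0]
    rfl
  simp only [condition, mass, Finset.sum_mul, hc] at h
  simp only [mul_sub, Finset.sum_sub_distrib, h]
  simp only [mul_assoc, sub_self]

/-- The extreme exchangeable families are the tensor powers of a pure state. -/
theorem exists_eq_prod_of_mem_extremePoints (hW : IsContractive W)
    (hρ : ρ ∈ (exchangeableStates W).extremePoints ℝ) :
    ∃ ψ : ι → ℂ, ∑ a, ‖ψ a‖ ^ 2 = 1 ∧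
      (∀ a c, ρ 1 (fun _ => a) (fun _ => c) = ψ a * star (ψ c)) ∧
      ∀ k, WithLp.toLp 2 (fun i : Fin k → ι => ∏ t, ψ (i t)) ∈ W k := by
  set r : ι → ι → ℂ := fun a c => ρ 1 (fun _ => a) (fun _ => c) with hr
  have hex : IsExchangeable W ρ := hρ.1.1
  have hc : ∀ i : Fin 1 → ι, i = fun _ => i 0 := fun i => by
    funext t
    rw [Subsingleton.elim t 0]
  have hprod : ∀ k (i j : Fin k → ι), ρ k i j = ∏ t, r (i t) (j t) := by
    intro k
    induction k with
    | zero =>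
      intro i j
      rw [Subsingleton.elim i default, Subsingleton.elim j default, Fin.prod_univ_zero]
      exact hρ.1.2
    | succ k ih =>
      intro i j
      rw [← Fin.cons_self_tail i, ← Fin.cons_self_tail j, apply_cons_of_mem_extremePoints hW hρ, ih,
        Fin.prod_univ_succ]
      rfl
  -- Symmetry of the columns of $\rho_2=r\otimes r$ makes all $2\times2$ minors of `r` vanish, so
  -- `r` has rank one.
  have hswap : ∀ a b c d, r a c * r b d = r b c * r a d := by
    intro a b c d
    have h := apply_snoc_of_mem_symTensors (hW.le_symTensors _ (hex.column_mem 2 ![c, d]))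
      (fun _ => a) b
    simp only [hprod, Fin.prod_univ_two] at h
    exact h
  have htr : ∑ a, r a a = 1 := by
    rw [← hρ.1.2, ← hex.trace_eq 1, sum_cons]
    refine Finset.sum_congr rfl fun a _ => ?_
    rw [Fintype.sum_unique, hc (Fin.cons a default)]
    rfl
  obtain ⟨c, hc0⟩ : ∃ c, r c c ≠ 0 := by
    by_contra! h
    simp [h] at htr
  have hcc : 0 ≤ r c c := (hex.posSemidef 1).diag_nonneg
  set m : ℝ := (r c c).re with hm
  have hrm : r c c = m := by
    rw [Complex.le_def] at hcc
    exact Complex.ext rfl (by simpa using hcc.2.symm)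
  have hmpos : 0 < m := by
    refine lt_of_le_of_ne (Complex.le_def.1 hcc).1 fun h => hc0 ?_
    rw [hrm, ← h]
    simp
  have hsq : ((Real.sqrt m : ℝ) : ℂ) * (Real.sqrt m : ℝ) = m := by
    rw [← Complex.ofReal_mul, Real.mul_self_sqrt hmpos.le]
  have hs0 : ((Real.sqrt m : ℝ) : ℂ) ≠ 0 := by
    exact_mod_cast (Real.sqrt_pos.2 hmpos).ne'
  have hm0 : (m : ℂ) ≠ 0 := by exact_mod_cast hmpos.ne'
  -- If $r=\psi\psi^*$, its column `c` is $\overline{\psi_c}\,\psi$; the phase is fixed by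
  -- $\psi_c=\sqrt m>0$.
  let ψ : ι → ℂ := fun a => r a c / (Real.sqrt m : ℝ)
  have hψ : ∀ a b, r a b = ψ a * star (ψ b) := by
    intro a b
    have h1 : star (r b c) = r c b := hex.star_apply _ _
    have h2 : star ((Real.sqrt m : ℝ) : ℂ) = (Real.sqrt m : ℝ) := Complex.conj_ofReal _
    simp only [ψ, star_div₀, h1, h2]
    rw [div_mul_div_comm, hsq, hswap a c c b, hrm, mul_div_cancel_left₀ _ hm0]
  refine ⟨ψ, ?_, hψ, fun k => ?_⟩
  · have : ((∑ a, ‖ψ a‖ ^ 2 : ℝ) : ℂ) = 1 := by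
      rw [← htr]
      push_cast
      refine Finset.sum_congr rfl fun a _ => ?_
      rw [hψ]
      exact (Complex.mul_conj' _).symm
    exact_mod_cast this
  · have hψc : star (ψ c) ≠ 0 := by
      refine star_ne_zero.2 fun h => hc0 ?_
      rw [hψ, h, zero_mul]
    -- The column of $\rho_k$ at $(c,\dots,c)$ is $\overline{\psi_c}^{\,k}\psi^{\otimes k}$.
    have h := (W k).smul_mem ((star (ψ c)) ^ k)⁻¹ (hex.column_mem k fun _ => c)
    convert h using 1
    ext i
    simp only [hprod, hψ, Finset.prod_mul_distrib, Finset.prod_const, Finset.card_univ,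
      Fintype.card_fin, PiLp.smul_apply, smul_eq_mul]
    field_simp

end XTangle

/-! ### Compactness and the existence of limiting families. -/

namespace XTangle
open Filter Topology
open scoped ComplexOrder

/-- The kernels with all entries of modulus at most one. -/
def unitKernels (ι : Type*) : Set (TensorKernels ι) :=
  {ρ | ∀ k i j, ‖ρ k i j‖ ≤ 1}

theorem isCompact_unitKernels {ι : Type*} : IsCompact (unitKernels ι) := by
  have : unitKernels ι = Set.univ.pi fun _ => Set.univ.pi fun _ => Set.univ.pi fun _ =>
      Metric.closedBall (0 : ℂ) 1 := by
    ext ρ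
    simp [unitKernels, Set.mem_pi]
  rw [this]
  exact isCompact_univ_pi fun _ => isCompact_univ_pi fun _ => isCompact_univ_pi fun _ =>
    isCompact_closedBall 0 1

variable {ι : Type*} [Fintype ι] {W : (k : ℕ) → Submodule ℂ (Tensors ι k)}

theorem isClosed_posSemidef (k : ℕ) :
    IsClosed {ρ : TensorKernels ι | (Matrix.of (ρ k)).PosSemidef} := by
  have : {ρ : TensorKernels ι | (Matrix.of (ρ k)).PosSemidef} =
      {ρ | ∀ i j, star (ρ k j i) = ρ k i j} ∩
        {ρ | ∀ x : (Fin k → ι) → ℂ, 0 ≤ ∑ i, star (x i) * ∑ j, ρ k i j * x j} := by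
    ext ρ
    rw [Set.mem_ofPred_eq, Matrix.posSemidef_iff_dotProduct_mulVec, Matrix.IsHermitian.ext_iff]
    rfl
  rw [this]
  refine IsClosed.inter ?_ ?_
  · simp only [Set.ofPred_forall]
    exact isClosed_iInter fun i => isClosed_iInter fun j =>
      isClosed_eq (by fun_prop) (by fun_prop)
  · simp only [Set.ofPred_forall]
    exact isClosed_iInter fun x => isClosed_le (by fun_prop) (by fun_prop)

theorem isClosed_column_mem (W : (k : ℕ) → Submodule ℂ (Tensors ι k)) (k : ℕ) :
    IsClosed {ρ : TensorKernels ι | ∀ j, WithLp.toLp 2 (fun i => ρ k i j) ∈ W k} := by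
  simp only [Set.ofPred_forall]
  exact isClosed_iInter fun j => (W k).closed_of_finiteDimensional.preimage
    ((PiLp.continuous_toLp 2 _).comp (by fun_prop))

theorem isClosed_sum_snoc (k : ℕ) :
    IsClosed {ρ : TensorKernels ι |
      ∀ i j, ∑ a, ρ (k + 1) (Fin.snoc i a) (Fin.snoc j a) = ρ k i j} := by
  simp only [Set.ofPred_forall]
  exact isClosed_iInter fun i => isClosed_iInter fun j => isClosed_eq (by fun_prop) (by fun_prop)

theorem isCompact_exchangeableStates : IsCompact (exchangeableStates W) := by
  refine isCompact_unitKernels.of_isClosed_subset ?_ fun ρ h k i j => ?_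
  · have : exchangeableStates W =
        ((⋂ k, {ρ | (Matrix.of (ρ k)).PosSemidef}) ∩
          (⋂ k, {ρ | ∀ j, WithLp.toLp 2 (fun i => ρ k i j) ∈ W k}) ∩
          ⋂ k, {ρ | ∀ i j, ∑ a, ρ (k + 1) (Fin.snoc i a) (Fin.snoc j a) = ρ k i j}) ∩
        {ρ | mass ρ = 1} := by
      ext ρ
      simp only [Set.mem_inter_iff, Set.mem_iInter, Set.mem_ofPred_eq]
      exact ⟨fun h => ⟨⟨⟨h.1.1, h.1.2⟩, h.1.3⟩, h.2⟩, fun h => ⟨⟨h.1.1.1, h.1.1.2, h.1.2⟩, h.2⟩⟩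
    rw [this]
    refine (((isClosed_iInter isClosed_posSemidef).inter
      (isClosed_iInter (isClosed_column_mem W))).inter (isClosed_iInter isClosed_sum_snoc)).inter ?_
    exact isClosed_eq (by unfold mass; fun_prop) (by fun_prop)
  · simpa [h.2] using h.1.norm_apply_le i j

/-- The expectation of a one-particle matrix in a family of kernels. -/
noncomputable def expectation (h : ι → ι → ℂ) : StrongDual ℝ (TensorKernels ι) where
  toFun ρ := (∑ a, ∑ c, h a c * ρ 1 (fun _ => c) (fun _ => a)).re
  map_add' ρ σ := by
    simp only [Pi.add_apply, mul_add, Finset.sum_add_distrib, Complex.add_re]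
  map_smul' r ρ := by
    simp [Complex.real_smul, mul_left_comm _ (r : ℂ), ← Finset.mul_sum]
  cont := by fun_prop

theorem expectation_apply (h : ι → ι → ℂ) (ρ : TensorKernels ι) :
    expectation h ρ = (∑ a, ∑ c, h a c * ρ 1 (fun _ => c) (fun _ => a)).re := rfl

/-- The maximizers of the expectation form a nonempty compact exposed face. By Krein–Milman it has
an extreme point, which is extreme among all exchangeable states. -/
theorem exists_expectation_le (hW : IsContractive W) (h : ι → ι → ℂ) {ρ : TensorKernels ι}
    (hρ : ρ ∈ exchangeableStates W) :
    ∃ ψ : ι → ℂ, ∑ a, ‖ψ a‖ ^ 2 = 1 ∧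
      (∀ k, WithLp.toLp 2 (fun i : Fin k → ι => ∏ t, ψ (i t)) ∈ W k) ∧
      expectation h ρ ≤ (∑ a, ∑ c, h a c * (ψ c * star (ψ a))).re := by
  have hexp : IsExposed ℝ (exchangeableStates W)
      ((expectation h).toExposed (exchangeableStates W)) :=
    ContinuousLinearMap.toExposed.isExposed
  obtain ⟨σ, hσ, hmax⟩ := isCompact_exchangeableStates.exists_isMaxOn ⟨ρ, hρ⟩
    (expectation h).continuous.continuousOn
  obtain ⟨τ, hτ⟩ := (hexp.isCompact isCompact_exchangeableStates).extremePoints_nonempty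
    ⟨σ, hσ, hmax⟩
  obtain ⟨ψ, hψ, h1, hmem⟩ := exists_eq_prod_of_mem_extremePoints hW
    (hexp.isExtreme.extremePoints_subset_extremePoints hτ)
  refine ⟨ψ, hψ, hmem, ?_⟩
  have := hτ.1.2 ρ hρ
  simpa only [expectation_apply h τ, h1] using this

/-- Repeated partial traces of `M` over the last factor fill the levels below `n`. The zeros above
`n` are placeholders, which disappear in the limit `n → ∞`. -/
theorem exists_truncated (hW : IsContractive W) :
    ∀ (n : ℕ) (M : (Fin n → ι) → (Fin n → ι) → ℂ), (Matrix.of M).PosSemidef →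
      (∀ j, WithLp.toLp 2 (fun i => M i j) ∈ W n) →
      ∃ ρ : TensorKernels ι, ρ n = M ∧ (∀ k, n < k → ρ k = 0) ∧
        (∀ k ≤ n, (Matrix.of (ρ k)).PosSemidef) ∧
        (∀ k ≤ n, ∀ j, WithLp.toLp 2 (fun i => ρ k i j) ∈ W k) ∧
        ∀ k < n, ∀ i j, ∑ a, ρ (k + 1) (Fin.snoc i a) (Fin.snoc j a) = ρ k i j := by
  intro n
  induction n with
  | zero =>
    intro M hM hMW
    refine ⟨Function.update 0 0 M, by simp, fun k hk => by simp [hk.ne'], ?_, ?_, by simp⟩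
    · intro k hk
      obtain rfl : k = 0 := by omega
      simpa using hM
    · intro k hk
      obtain rfl : k = 0 := by omega
      simpa using hMW
  | succ n ih =>
    intro M hM hMW
    obtain ⟨ρ, hn, h0, hpos, hcol, hsum⟩ := ih
      (fun i j => ∑ a, M (Fin.snoc i a) (Fin.snoc j a))
      (by
        have := Matrix.posSemidef_sum Finset.univ fun (a : ι) _ =>
          hM.submatrix fun i : Fin n → ι => (Fin.snoc i a : Fin (n + 1) → ι)
        convert this
        ext i j
        simp [Matrix.sum_apply])
      (fun j => by
        have : WithLp.toLp 2 (fun i : Fin n → ι => ∑ a, M (Fin.snoc i a) (Fin.snoc j a)) =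
            ∑ a, lastSlice (WithLp.toLp 2 fun i => M i (Fin.snoc j a)) a := by
          ext i
          simp
        rw [this]
        exact sum_mem fun a _ => hW.lastSlice_mem (hMW _) a)
    have hne : ∀ k ≤ n, Function.update ρ (n + 1) M k = ρ k := fun k hk =>
      Function.update_of_ne (by omega) _ _
    refine ⟨Function.update ρ (n + 1) M, by simp, fun k hk => ?_, fun k hk => ?_, fun k hk => ?_,
      fun k hk => ?_⟩
    · rw [Function.update_of_ne (by omega), h0 k (by omega)]
    · rcases hk.eq_or_lt with rfl | hk
      · simpa using hM
      · rw [hne k (by omega)]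
        exact hpos k (by omega)
    · rcases hk.eq_or_lt with rfl | hk
      · simpa using hMW
      · rw [hne k (by omega)]
        exact hcol k (by omega)
    · rw [hne k (by omega)]
      rcases (Nat.lt_succ_iff.1 hk).eq_or_lt with rfl | hk
      · rw [Function.update_self, hn]
        exact fun _ _ => rfl
      · rw [hne (k + 1) (by omega)]
        exact hsum k hk

theorem sum_cons_cons_eq {ρ : TensorKernels ι} {n : ℕ}
    (h : ∀ k < n + 1, ∀ i j, ∑ a, ρ (k + 1) (Fin.snoc i a) (Fin.snoc j a) = ρ k i j) (a c : ι) :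
    ∑ i : Fin n → ι, ρ (n + 1) (Fin.cons c i) (Fin.cons a i)
      = ρ 1 (fun _ => c) (fun _ => a) := by
  induction n with
  | zero =>
    have hc : ∀ a : ι, (Fin.cons a default : Fin 1 → ι) = fun _ => a := fun a => by
      funext t
      rw [Subsingleton.elim (α := Fin 1) t 0]
      rfl
    rw [Fintype.sum_unique]
    exact congrArg₂ (ρ 1) (hc c) (hc a)
  | succ n ih =>
    rw [sum_snoc, Finset.sum_comm, ← ih fun k hk => h k (by omega)]
    refine Finset.sum_congr rfl fun i _ => ?_
    simp only [Fin.cons_snoc_eq_snoc_cons]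
    exact h (n + 1) (by omega) _ _

theorem exists_exchangeable_of_forall_level (hW : IsContractive W) (h : ι → ι → ℂ) {ν : ℝ}
    (v : ∀ n, Tensors ι (n + 1)) (hv : ∀ n, v n ∈ W (n + 1)) (hv1 : ∀ n, ‖v n‖ = 1)
    (hν : ∀ n, ν ≤ (∑ a, ∑ c, h a c *
      ∑ i : Fin n → ι, v n (Fin.cons c i) * star (v n (Fin.cons a i))).re) :
    ∃ ρ ∈ exchangeableStates W, ν ≤ expectation h ρ := by
  choose ρ hn h0 hpos hcol hsum using fun n => exists_truncated hW (n + 1)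
    (fun i j => v n i * star (v n j)) (Matrix.posSemidef_vecMulVec_self_star (v n).ofLp)
    (fun j => by
      have : WithLp.toLp 2 (fun i => v n i * star (v n j)) = star (v n j) • v n := by
        ext i
        simp [mul_comm]
      rw [this]
      exact (W (n + 1)).smul_mem _ (hv n))
  have hmass : ∀ n, mass (ρ n) = 1 := fun n => by
    rw [← sum_diag_eq_mass (hsum n), hn]
    have := EuclideanSpace.norm_sq_eq (v n)
    rw [hv1, one_pow] at this
    rw [← Complex.ofReal_one, this]
    push_cast
    exact Finset.sum_congr rfl fun i _ => Complex.mul_conj' _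
  have hunit : ∀ n, ρ n ∈ unitKernels ι := fun n k i j => by
    by_cases hk : k ≤ n + 1
    · have h1 := norm_apply_le_trace (hpos n k hk) i j
      have h2 : (Matrix.of (ρ n k)).trace = 1 :=
        (sum_diag_eq_mass fun l hl => hsum n l (by omega)).trans (hmass n)
      rw [h2] at h1
      exact h1
    · rw [h0 n k (by omega)]
      simp
  have hexpect : ∀ n, ν ≤ expectation h (ρ n) := fun n => by
    refine (hν n).trans_eq ?_
    simp only [expectation_apply, ← sum_cons_cons_eq (hsum n), hn]
  -- Limit along a nonprincipal ultrafilter. Each requirement at a fixed level is closed and holds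
  -- for all large `n`, so it passes to `τ`.
  obtain ⟨τ, -, hτ⟩ := isCompact_unitKernels.ultrafilter_le_nhds
    ((hyperfilter ℕ).map ρ) (le_principal_iff.2 (Filter.mem_map.2 (Filter.univ_mem' hunit)))
  have hlim : Tendsto ρ (hyperfilter ℕ) (𝓝 τ) := hτ
  have hev : ∀ k, ∀ᶠ n in (hyperfilter ℕ : Filter ℕ), k < n := fun k =>
    Nat.hyperfilter_le_atTop (eventually_gt_atTop k)
  refine ⟨τ, ⟨⟨fun k => ?_, fun k => ?_, fun k => ?_⟩, ?_⟩, ?_⟩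
  · exact (isClosed_posSemidef k).mem_of_tendsto hlim
      ((hev k).mono fun n hn => hpos n k (by omega))
  · exact (isClosed_column_mem W k).mem_of_tendsto hlim
      ((hev k).mono fun n hn => hcol n k (by omega))
  · exact (isClosed_sum_snoc k).mem_of_tendsto hlim
      ((hev k).mono fun n hn => hsum n k (by omega))
  · have hc : Continuous fun ρ : TensorKernels ι => mass ρ := by unfold mass; fun_prop
    exact (isClosed_eq hc continuous_const).mem_of_tendsto hlim (Eventually.of_forall hmass)
  · exact ge_of_tendsto (((expectation h).continuous.tendsto τ).comp hlim)
      (Eventually.of_forall hexpect)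

end XTangle

namespace XTangle
open Filter Topology

/-! ### Monotonicity and convergence of the hierarchy. -/

section Hierarchy

variable {E : Type*} [NormedAddCommGroup E] [InnerProductSpace ℂ E]
variable {ι : Type*} [Fintype ι]

theorem sum_norm_sq_lastSlice {k : ℕ} (v : Tensors ι (k + 1)) :
    ∑ e, ‖lastSlice v e‖ ^ 2 = ‖v‖ ^ 2 := by
  simp only [EuclideanSpace.norm_sq_eq, lastSlice_apply]
  exact (sum_snoc fun i => ‖v i‖ ^ 2).symm

theorem ne_bot_of_pureState_mem (b : OrthonormalBasis ι ℂ E)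
    {W : (k : ℕ) → Submodule ℂ (Tensors ι k)} {X : Set (E →L[ℂ] E)}
    (hX : ∀ ψ : E, pureState ψ ∈ X ↔
      ‖ψ‖ = 1 ∧ ∀ k, (productTensor b fun _ : Fin k => ψ) ∈ W k) {ψ : E} (hψ : pureState ψ ∈ X) (k : ℕ) : W k ≠ ⊥ := by
  obtain ⟨h1, hmem⟩ := (hX ψ).1 hψ
  refine (Submodule.ne_bot_iff _).2 ⟨_, hmem k, fun h0 => ?_⟩
  have := norm_productTensor b fun _ : Fin k => ψ
  simp [h0, h1] at this

variable [DecidableEq ι] (b : OrthonormalBasis ι ℂ E)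

/-- `H` acts on the first factor, so cutting along the last one splits the expectation into a sum.
There must be two distinct factors, hence `k + 2`. -/
theorem sum_inner_onFirst_lastSlice {k : ℕ} (H : E →ₗ[ℂ] E) (v : Tensors ι (k + 2)) :
    ∑ e, ⟪lastSlice v e, onFirst b (k + 1) H (lastSlice v e)⟫_ℂ
      = ⟪v, onFirst b (k + 2) H v⟫_ℂ := by
  simp only [inner_onFirst]
  rw [Finset.sum_comm]
  refine Finset.sum_congr rfl fun a _ => ?_
  rw [Finset.sum_comm]
  refine Finset.sum_congr rfl fun c _ => ?_
  rw [← Finset.mul_sum, sum_snoc]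
  simp only [lastSlice_apply, Fin.cons_snoc_eq_snoc_cons]

theorem inner_eq_sum_repr (H : E →ₗ[ℂ] E) {ψ : E} (hψ : ‖ψ‖ = 1) :
    ⟪ψ, H ψ⟫_ℂ = ∑ a, ∑ c, ⟪b a, H (b c)⟫_ℂ * (b.repr ψ c * star (b.repr ψ a)) := by
  rw [← inner_onFirst_productTensor b le_rfl H hψ, inner_onFirst]
  simp [productTensor]

variable {W : (k : ℕ) → Submodule ℂ (Tensors ι k)} {X : Set (E →L[ℂ] E)}

theorem exists_le_inner_of_forall_level (hW : IsContractive W) (H : E →ₗ[ℂ] E) {ν : ℝ}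
    (v : ∀ n, Tensors ι (n + 1)) (hv : ∀ n, v n ∈ W (n + 1)) (hv1 : ∀ n, ‖v n‖ = 1)
    (hν : ∀ n, ν ≤ (⟪v n, onFirst b (n + 1) H (v n)⟫_ℂ).re) :
    ∃ ψ : E, ‖ψ‖ = 1 ∧ (∀ k, (productTensor b fun _ : Fin k => ψ) ∈ W k) ∧
      ν ≤ (⟪ψ, H ψ⟫_ℂ).re := by
  simp only [inner_onFirst] at hν
  obtain ⟨ρ, hρ, hνρ⟩ := exists_exchangeable_of_forall_level hW _ v hv hv1 hν
  obtain ⟨φ, hφ, hmem, hle⟩ := exists_expectation_le hW (fun a c => ⟪b a, H (b c)⟫_ℂ) hρ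
  set ψ : E := b.repr.symm (WithLp.toLp 2 φ) with hψ
  have hr : ∀ a, b.repr ψ a = φ a := fun a => by simp [hψ]
  have hn : ‖ψ‖ = 1 := by
    rw [hψ, LinearIsometryEquiv.norm_map, EuclideanSpace.norm_eq, Real.sqrt_eq_one]
    exact hφ
  refine ⟨ψ, hn, fun k => ?_, ?_⟩
  · have : (productTensor b fun _ : Fin k => ψ) = WithLp.toLp 2 fun i => ∏ t, φ (i t) := by
      ext i
      simp [productTensor, hr]
    rw [this]
    exact hmem k
  · rw [inner_eq_sum_repr b H hn]
    simp only [hr]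
    exact hνρ.trans hle

variable (hX : ∀ ψ : E, pureState ψ ∈ X ↔
  ‖ψ‖ = 1 ∧ ∀ k, (productTensor b fun _ : Fin k => ψ) ∈ W k)
include hX

variable (hne : ∃ ψ : E, pureState ψ ∈ X) (hW : IsContractive W) {H : E →ₗ[ℂ] E}
  (hH : H.IsSymmetric)
include hne hH

theorem isGreatest_lambdaMax (k : ℕ) :
    IsGreatest (eigenvaluesOn (W k) (levelOp b (W k) H)) (lambdaMax (W k) (levelOp b (W k) H)) :=
  have ⟨_, hψ⟩ := hne
  (isGreatest_eigenvaluesOn (ne_bot_of_pureState_mem b hX hψ k) (levelOp_isSymmetric b (W k) hH)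
    fun v _ => levelOp_mem b (W k) H v).1

theorem re_inner_onFirst_le {k : ℕ} {v : Tensors ι k} (hv : v ∈ W k) :
    (⟪v, onFirst b k H v⟫_ℂ).re ≤ lambdaMax (W k) (levelOp b (W k) H) * ‖v‖ ^ 2 := by
  obtain ⟨_, hψ⟩ := hne
  rw [← inner_levelOp b (W k) H hv]
  exact (isGreatest_eigenvaluesOn (ne_bot_of_pureState_mem b hX hψ k)
    (levelOp_isSymmetric b (W k) hH) fun v _ => levelOp_mem b (W k) H v).2 v hv

theorem exists_re_inner_onFirst_eq (k : ℕ) :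
    ∃ v ∈ W k, ‖v‖ = 1 ∧
      (⟪v, onFirst b k H v⟫_ℂ).re = lambdaMax (W k) (levelOp b (W k) H) := by
  obtain ⟨v, hv, hv0, hTv⟩ := (isGreatest_lambdaMax b hX hne hH k).1
  have hn : ‖((‖v‖⁻¹ : ℝ) : ℂ) • v‖ = 1 := by
    rw [norm_smul, Complex.norm_real, norm_inv, norm_norm, inv_mul_cancel₀ (norm_ne_zero_iff.2 hv0)]
  refine ⟨((‖v‖⁻¹ : ℝ) : ℂ) • v, (W k).smul_mem _ hv, hn, ?_⟩
  rw [← inner_levelOp b (W k) H ((W k).smul_mem _ hv),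
    re_inner_eigenvector (μ := lambdaMax (W k) (levelOp b (W k) H)), hn, one_pow, mul_one]
  rw [map_smul, hTv, smul_comm]

theorem le_lambdaMax {ψ : E} (hψ : pureState ψ ∈ X) {k : ℕ} (hk : 1 ≤ k) :
    (⟪ψ, H ψ⟫_ℂ).re ≤ lambdaMax (W k) (levelOp b (W k) H) := by
  obtain ⟨h1, hmem⟩ := (hX ψ).1 hψ
  have := re_inner_onFirst_le b hX hne hH (hmem k)
  rw [inner_onFirst_productTensor b hk H h1, norm_productTensor] at this
  simpa [h1] using this

include hW

theorem lambdaMax_succ_le (k : ℕ) :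
    lambdaMax (W (k + 2)) (levelOp b (W (k + 2)) H)
      ≤ lambdaMax (W (k + 1)) (levelOp b (W (k + 1)) H) := by
  obtain ⟨v, hv, hv1, hveq⟩ := exists_re_inner_onFirst_eq b hX hne hH (k + 2)
  rw [← hveq, ← sum_inner_onFirst_lastSlice, Complex.re_sum]
  refine (Finset.sum_le_sum fun e _ =>
    re_inner_onFirst_le b hX hne hH (hW.lastSlice_mem hv e)).trans_eq ?_
  rw [← Finset.mul_sum, sum_norm_sq_lastSlice, hv1, one_pow, mul_one]

theorem antitone_lambdaMax :
    Antitone fun n => lambdaMax (W (n + 1)) (levelOp b (W (n + 1)) H) :=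
  antitone_nat_of_succ_le fun n => lambdaMax_succ_le b hX hne hW hH n

theorem antitoneOn_lambdaMax :
    AntitoneOn (fun k => lambdaMax (W k) (levelOp b (W k) H)) (Set.Ici 1) := by
  intro k hk l hl hkl
  obtain ⟨k, rfl⟩ := Nat.exists_eq_add_of_le' (Set.mem_Ici.1 hk)
  obtain ⟨l, rfl⟩ := Nat.exists_eq_add_of_le' (Set.mem_Ici.1 hl)
  exact antitone_lambdaMax b hX hne hW hH (by omega)

theorem isGreatest_maxOn_and_tendsto :
    IsGreatest (valuesOn X H) (maxOn X H) ∧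
      Tendsto (fun k => lambdaMax (W k) (levelOp b (W k) H)) atTop (𝓝 (maxOn X H)) := by
  set u : ℕ → ℝ := fun n => lambdaMax (W (n + 1)) (levelOp b (W (n + 1)) H) with hu
  have hle : ∀ ψ : E, pureState ψ ∈ X → ∀ n, (⟪ψ, H ψ⟫_ℂ).re ≤ u n := fun ψ hψ n =>
    le_lambdaMax b hX hne hH hψ (by omega)
  obtain ⟨ψ₀, hψ₀⟩ := hne
  have hbdd : BddBelow (Set.range u) := ⟨_, by rintro _ ⟨n, rfl⟩; exact hle ψ₀ hψ₀ n⟩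
  have htend := tendsto_atTop_ciInf (antitone_lambdaMax b hX ⟨ψ₀, hψ₀⟩ hW hH) hbdd
  choose v hv hv1 hveq using fun n => exists_re_inner_onFirst_eq b hX ⟨ψ₀, hψ₀⟩ hH (n + 1)
  -- The infimum of the levels bounds all values on `X` from above, and this `ψ` reaches it:
  -- existence of the maximum and the limit come together.
  obtain ⟨ψ, h1, hmem, hψ⟩ := exists_le_inner_of_forall_level b hW H v hv hv1
    fun n => (ciInf_le hbdd n).trans_eq (hveq n).symm
  have hψX := (hX ψ).2 ⟨h1, hmem⟩
  have hgr : IsGreatest (valuesOn X H) (⨅ n, u n) := by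
    refine ⟨⟨ψ, hψX, hψ.antisymm (le_ciInf (hle ψ hψX))⟩, ?_⟩
    rintro _ ⟨χ, hχ, rfl⟩
    exact le_ciInf (hle χ hχ)
  have hmax : maxOn X H = ⨅ n, u n := hgr.csSup_eq
  rw [hmax]
  exact ⟨hgr, (tendsto_add_atTop_iff_nat 1).1 htend⟩

theorem isGreatest_eigenvaluesOn_top_levelOp (h0 : 0 ≤ maxOn X H) {k : ℕ} (hk : 1 ≤ k) :
    IsGreatest (eigenvaluesOn ⊤ (levelOp b (W k) H)) (lambdaMax (W k) (levelOp b (W k) H)) := by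
  obtain ⟨ψ, hψ, hval⟩ := (isGreatest_maxOn_and_tendsto b hX hne hW hH).1.1
  refine isGreatest_eigenvaluesOn_top (levelOp_mem b (W k) H) (h0.trans ?_)
    (isGreatest_lambdaMax b hX hne hH k)
  rw [hval]
  exact le_lambdaMax b hX hne hH hψ hk

end Hierarchy

end XTangle

/-- The hierarchy of eigenvalue computations, for `W k = I_k^⊥` and for `W k = X^k`. Every level is
taken as an operator on `W k`; the largest (smallest) eigenvalue on the whole tensor power is the
same number as soon as the maximum (minimum) over `X` is nonnegative (nonpositive). -/
theorem mainTheorem7 {E : Type*} [NormedAddCommGroup E] [InnerProductSpace ℂ E]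
    [FiniteDimensional ℂ E] {ι : Type*} [Fintype ι] [DecidableEq ι]
    (b : OrthonormalBasis ι ℂ E)
    (I : Ideal (MvPolynomial ι ℂ))
    (hI : I.IsHomogeneous (MvPolynomial.homogeneousSubmodule ι ℂ))
    (X : Set (E →L[ℂ] E)) (hX : X = XTangle.variety b I) (hne : X.Nonempty)
    (W : (k : ℕ) → Submodule ℂ (XTangle.Tensors ι k))
    (hW : W = XTangle.idealPerp I ∨ W = XTangle.varietyPower b X) :
    (∀ H : E →ₗ[ℂ] E, H.IsSymmetric →
      -- the largest eigenvalues decrease to the maximum over `X`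
      (IsGreatest (XTangle.valuesOn X H) (XTangle.maxOn X H) ∧
        (∀ k, 1 ≤ k → IsGreatest (XTangle.eigenvaluesOn (W k) (XTangle.levelOp b (W k) H))
          (XTangle.lambdaMax (W k) (XTangle.levelOp b (W k) H))) ∧
        AntitoneOn (fun k => XTangle.lambdaMax (W k) (XTangle.levelOp b (W k) H)) (Set.Ici 1) ∧
        Filter.Tendsto (fun k => XTangle.lambdaMax (W k) (XTangle.levelOp b (W k) H))
          Filter.atTop (nhds (XTangle.maxOn X H)) ∧
        (0 ≤ XTangle.maxOn X H → ∀ k, 1 ≤ k →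
          IsGreatest (XTangle.eigenvaluesOn ⊤ (XTangle.levelOp b (W k) H))
            (XTangle.lambdaMax (W k) (XTangle.levelOp b (W k) H)))) ∧
      -- the smallest eigenvalues increase to the minimum over `X`
      (IsLeast (XTangle.valuesOn X H) (XTangle.minOn X H) ∧
        (∀ k, 1 ≤ k → IsLeast (XTangle.eigenvaluesOn (W k) (XTangle.levelOp b (W k) H))
          (XTangle.lambdaMin (W k) (XTangle.levelOp b (W k) H))) ∧
        MonotoneOn (fun k => XTangle.lambdaMin (W k) (XTangle.levelOp b (W k) H)) (Set.Ici 1) ∧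
        Filter.Tendsto (fun k => XTangle.lambdaMin (W k) (XTangle.levelOp b (W k) H))
          Filter.atTop (nhds (XTangle.minOn X H)) ∧
        (XTangle.minOn X H ≤ 0 → ∀ k, 1 ≤ k →
          IsLeast (XTangle.eigenvaluesOn ⊤ (XTangle.levelOp b (W k) H))
            (XTangle.lambdaMin (W k) (XTangle.levelOp b (W k) H))))) ∧
    -- the geometric measure of a subspace, with eigenvalues on the whole tensor power
    (∀ U : Submodule ℂ E,
      IsGreatest (XTangle.valuesOn X U.starProjection.toLinearMap)
        (1 - XTangle.geometricMeasure X U) ∧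
      (∀ k, 1 ≤ k →
        IsGreatest (XTangle.eigenvaluesOn ⊤ (XTangle.levelOp b (W k) U.starProjection.toLinearMap))
          (XTangle.lambdaMax ⊤ (XTangle.levelOp b (W k) U.starProjection.toLinearMap))) ∧
      AntitoneOn
        (fun k => XTangle.lambdaMax ⊤ (XTangle.levelOp b (W k) U.starProjection.toLinearMap))
        (Set.Ici 1) ∧
      Filter.Tendsto
        (fun k => 1 - XTangle.lambdaMax ⊤ (XTangle.levelOp b (W k) U.starProjection.toLinearMap))
        Filter.atTop (nhds (XTangle.geometricMeasure X U))) := by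

  subst hX
  have hX := fun ψ : E => XTangle.pureState_mem_iff b hI hW (ψ := ψ)
  have hC : XTangle.IsContractive W := by
    rcases hW with rfl | rfl
    · exact XTangle.isContractive_idealPerp I
    · exact XTangle.isContractive_varietyPower b _
  have hne' : ∃ ψ : E, XTangle.pureState ψ ∈ XTangle.variety b I := by
    obtain ⟨_, ψ, h1, h2, rfl⟩ := hne
    exact ⟨ψ, ψ, h1, h2, rfl⟩
  refine ⟨fun H hH => ⟨?_, ?_⟩, fun U => ?_⟩
  · obtain ⟨hmax, hlim⟩ := XTangle.isGreatest_maxOn_and_tendsto b hX hne' hC hH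
    exact ⟨hmax, fun k _ => XTangle.isGreatest_lambdaMax b hX hne' hH k,
      XTangle.antitoneOn_lambdaMax b hX hne' hC hH, hlim,
      fun h0 k hk => XTangle.isGreatest_eigenvaluesOn_top_levelOp b hX hne' hC hH h0 hk⟩
  · have hH' : (-H).IsSymmetric := fun x y => by
      simp only [LinearMap.neg_apply, inner_neg_left, inner_neg_right, hH x y]
    have hmin : ∀ k, 1 ≤ k → XTangle.lambdaMin (W k) (XTangle.levelOp b (W k) H)
        = -XTangle.lambdaMax (W k) (XTangle.levelOp b (W k) (-H)) := fun k hk => by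
      rw [XTangle.lambdaMin_eq_neg, XTangle.levelOp_neg b (W k) hk]
    have hneg : ∀ k, 1 ≤ k → ∀ V : Submodule ℂ (XTangle.Tensors ι k),
        XTangle.eigenvaluesOn V (XTangle.levelOp b (W k) (-H))
          = -XTangle.eigenvaluesOn V (XTangle.levelOp b (W k) H) := fun k hk V => by
      rw [XTangle.levelOp_neg b (W k) hk, XTangle.eigenvaluesOn_neg]
    obtain ⟨hmax, hlim⟩ := XTangle.isGreatest_maxOn_and_tendsto b hX hne' hC hH'
    rw [XTangle.minOn_eq_neg]
    refine ⟨?_, fun k hk => ?_, fun k hk l hl hkl => ?_, ?_, fun h0 k hk => ?_⟩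
    · rw [XTangle.valuesOn_neg] at hmax
      exact XTangle.isLeast_neg_of_isGreatest hmax
    · have h := XTangle.isGreatest_lambdaMax b hX hne' hH' k
      rw [hneg k hk] at h
      rw [hmin k hk]
      exact XTangle.isLeast_neg_of_isGreatest h
    · simp only [hmin k hk, hmin l hl]
      exact neg_le_neg (XTangle.antitoneOn_lambdaMax b hX hne' hC hH' hk hl hkl)
    · refine hlim.neg.congr' ?_
      filter_upwards [Filter.eventually_ge_atTop 1] with k hk
      exact (hmin k hk).symm
    · have h := XTangle.isGreatest_eigenvaluesOn_top_levelOp b hX hne' hC hH' (by linarith) hk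
      rw [hneg k hk] at h
      rw [hmin k hk]
      exact XTangle.isLeast_neg_of_isGreatest h
  · have hH : U.starProjection.toLinearMap.IsSymmetric := fun x y =>
      U.inner_starProjection_left_eq_right x y
    obtain ⟨hmax, hlim⟩ := XTangle.isGreatest_maxOn_and_tendsto b hX hne' hC hH
    -- Positivity of $\Pi_U$ supplies the sign condition under which eigenvalues on `W k` and on the
    -- whole tensor power have the same maximum.
    have h0 : 0 ≤ XTangle.maxOn (XTangle.variety b I) U.starProjection.toLinearMap := by
      obtain ⟨ψ, -, hval⟩ := hmax.1
      rw [hval]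
      exact (U.re_inner_starProjection_nonneg ψ).trans_eq (congrArg Complex.re (hH ψ ψ))
    have htop := fun k (hk : 1 ≤ k) =>
      XTangle.isGreatest_eigenvaluesOn_top_levelOp b hX hne' hC hH h0 hk
    have heq : ∀ k, 1 ≤ k →
        XTangle.lambdaMax ⊤ (XTangle.levelOp b (W k) U.starProjection.toLinearMap)
          = XTangle.lambdaMax (W k) (XTangle.levelOp b (W k) U.starProjection.toLinearMap) :=
      fun k hk => (htop k hk).csSup_eq
    refine ⟨?_, fun k hk => ?_, fun k hk l hl hkl => ?_, ?_⟩
    · rw [XTangle.geometricMeasure, sub_sub_cancel]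
      exact hmax
    · rw [heq k hk]
      exact htop k hk
    · simp only [heq k hk, heq l hl]
      exact XTangle.antitoneOn_lambdaMax b hX hne' hC hH hk hl hkl
    · refine (hlim.const_sub 1).congr' ?_
      filter_upwards [Filter.eventually_ge_atTop 1] with k hk
      rw [heq k hk]
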